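/- Let $k\ge 2$ be an integer and let $S^2\subset\mathbb R^3$ be the unit sphere, oriented by its outward normal $\nu(p)=p$, with the metric induced from $\mathbb R^3$. Let $T^k_{sym,tr}S^2$ be the bundle whose fibre over $p$ is the space of tensors $Q\in\otimes^k T_pS^2$ that are invariant under all permutations of the $k$ factors and satisfy $\mathrm{tr}_{12}(Q)=0$, where $\mathrm{tr}_{12}(v_1\otimes\cdots\otimes v_k)=\langle v_1,v_2\rangle\, v_3\otimes\cdots\otimes v_k$. The fibres carry the inner product with $\langle v_1\otimes\cdots\otimes v_k,w_1\otimes\cdots\otimes w_k\rangle=\prod_j\langle v_j,w_j\rangle$ and the complex structure $J$ that rotates the first tensor factor by $+\pi/2$ in $T_pS^2$; equivalently, the rotation of $T_pS^2$ by the angle $\alpha$ acts on the fibre as $\cos(k\alpha)+\sin(k\alpha)J$. Then $T^k_{sym,tr}S^2$ is a smooth real vector bundle of rank $2$ and, with $J$, a hermitian line bundle (equivalently, an oriented Riemannian plane bundle), and its Euler number is $$e(T^k_{sym,tr}S^2)=2k .$$ Here the Euler number of a hermitian line bundle $L$ over $S^2$ is $e(L)=\frac1{2\pi}\int_{S^2}\kappa\,d\sigma$,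 where $\sigma$ is the surface area and $\kappa$ is the curvature of a smooth metric connection $\nabla$ on $L$, defined by $R^\nabla(X,Y)s=-\kappa\,\mathrm{vol}(X,Y)\,Js$ for all vector fields $X,Y$ and sections $s$. It is part of the claim that metric connections exist and that the value is $2k$ for every one of them. -/

import Mathlib

open scoped Manifold ContDiff TensorProduct RealInnerProductSpace

noncomputable section

/-! ### The round sphere in Euclidean three-space -/

/-- Euclidean three-space. -/
abbrev R3 : Type := EuclideanSpace ℝ (Fin 3)

/-- The unit sphere `S²`, with the manifold structure of Mathlib. -/
abbrev S2 : Type := Metric.sphere (0 : R3) 1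

namespace S2

/-- The tangent plane of the sphere at `p`: the orthogonal complement of the outward normal `p`. -/
def tangent (p : S2) : Submodule ℝ R3 := (ℝ ∙ (p : R3))ᗮ

/-- The cross product `v ↦ p × v`. On the tangent plane at `p` it is the rotation by the angle
`π / 2` that is positive for the orientation in which `(e₁, e₂)` is positively oriented if and only
if `(e₁, e₂, p)` is a positively oriented basis of `ℝ³`. -/
def rot (p : S2) : R3 →ₗ[ℝ] R3 :=
  (WithLp.linearEquiv 2 ℝ (Fin 3 → ℝ)).symm.toLinearMap ∘ₗ
    crossProduct (WithLp.ofLp (p : R3)) ∘ₗ (WithLp.linearEquiv 2 ℝ (Fin 3 → ℝ)).toLinearMap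

/-- The area form of the sphere: `vol p e₁ e₂ = 1` for a positively oriented orthonormal basis
`(e₁, e₂)` of the tangent plane at `p`. -/
def vol (p : S2) (v w : R3) : ℝ := ⟪rot p v, w⟫

/-- The surface area measure of the sphere (total mass `4 π`). -/
def area : MeasureTheory.Measure S2 := (MeasureTheory.volume : MeasureTheory.Measure R3).toSphere

/-- The radial retraction `x ↦ x / ‖x‖` of `ℝ³ \ {0}` onto the sphere, with an irrelevant value
at the origin. -/
def retract (x : R3) : S2 :=
  if h : x = 0 then ⟨EuclideanSpace.single 0 1, by simp⟩
  else ⟨‖x‖⁻¹ • x, by simp [norm_smul, h]⟩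

variable {W : Type*} [NormedAddCommGroup W] [NormedSpace ℝ W]

/-- Smooth maps from the sphere to a normed space. -/
def Smooth (f : S2 → W) : Prop := ContMDiff (𝓡 2) 𝓘(ℝ, W) ∞ f

/-- The derivative of `f : S² → W` at `p` in the direction of the tangent vector `v`. It is computed
on the extension of `f` to `ℝ³ \ {0}` which is constant along rays. -/
def dirDeriv (f : S2 → W) (p : S2) (v : R3) : W := fderiv ℝ (fun x => f (retract x)) (p : R3) v

/-- Smooth tangent vector fields on the sphere. -/
def IsVectorField (X : S2 → R3) : Prop := Smooth X ∧ ∀ p, X p ∈ tangent p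

/-- The Lie bracket `[X, Y] = D_X Y - D_Y X` of tangent vector fields of the sphere. -/
def bracket (X Y : S2 → R3) : S2 → R3 := fun p => dirDeriv Y p (X p) - dirDeriv X p (Y p)

end S2

/-! ### Hermitian line bundles, connections, curvature, Euler number

A family `E` of subspaces of a Euclidean space `V` is parametrized by the sphere; its fibres carry
the inner product of `V`. -/

section Bundles

open S2

variable {V : Type*} [NormedAddCommGroup V] [InnerProductSpace ℝ V]

/-- Smooth global sections of the family `E`. -/
def IsSection (E : S2 → Submodule ℝ V) (s : S2 → V) : Prop := Smooth s ∧ ∀ p, s p ∈ E p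

/-- `E` is a smooth rank-two subbundle of `S² × V`, and `J` is a smooth field of rotations by the
angle `π / 2` of its fibres. Thus `E` with the multiplication `i • v = J v` is a hermitian line
bundle or, what is the same, an oriented Riemannian bundle of rank two in which `(v, J v)`, `v ≠ 0`,
is a positively oriented basis. The existence of a smooth global section through each vector of a
fibre is the existence of smooth local frames (by cutting off). -/
structure IsHermitianLineBundle (E : S2 → Submodule ℝ V) (J : S2 → V →ₗ[ℝ] V) : Prop where
  finrank_eq : ∀ p, Module.finrank ℝ (E p) = 2
  exists_section : ∀ p, ∀ v ∈ E p, ∃ s, IsSection E s ∧ s p = v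
  J_mem : ∀ p, ∀ v ∈ E p, J p v ∈ E p
  J_J : ∀ p, ∀ v ∈ E p, J p (J p v) = -v
  J_inner : ∀ p, ∀ v ∈ E p, ∀ w ∈ E p, ⟪J p v, J p w⟫ = ⟪v, w⟫
  J_smooth : ∀ s, IsSection E s → IsSection E (fun p => J p (s p))

/-- Smooth metric connections on `E`: `D X s` is the covariant derivative `∇_X s` of the smooth
section `s` along the smooth vector field `X`. (The values of `D` at other arguments play no
role.) -/
structure MetricConnection (E : S2 → Submodule ℝ V) where
  D : (S2 → R3) → (S2 → V) → S2 → V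
  isSection : ∀ X s, IsVectorField X → IsSection E s → IsSection E (D X s)
  add_left : ∀ X Y s, IsVectorField X → IsVectorField Y → IsSection E s →
    D (fun p => X p + Y p) s = fun p => D X s p + D Y s p
  smul_left : ∀ (f : S2 → ℝ) (X) (s), Smooth f → IsVectorField X → IsSection E s →
    D (fun p => f p • X p) s = fun p => f p • D X s p
  add_right : ∀ X s t, IsVectorField X → IsSection E s → IsSection E t →
    D X (fun p => s p + t p) = fun p => D X s p + D X t p
  leibniz : ∀ (f : S2 → ℝ) (X) (s), Smooth f → IsVectorField X → IsSection E s →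
    D X (fun p => f p • s p) = fun p => dirDeriv f p (X p) • s p + f p • D X s p
  metric : ∀ X s t, IsVectorField X → IsSection E s → IsSection E t →
    ∀ p, dirDeriv (fun q => ⟪s q, t q⟫) p (X p) = ⟪D X s p, t p⟫ + ⟪s p, D X t p⟫

variable {E : S2 → Submodule ℝ V}

/-- The curvature operator
`R(X, Y) s = ∇_X ∇_Y s - ∇_Y ∇_X s - ∇_[X, Y] s` of a connection. -/
def MetricConnection.curv (A : MetricConnection E) (X Y : S2 → R3) (s : S2 → V) : S2 → V :=
  fun p => A.D X (A.D Y s) p - A.D Y (A.D X s) p - A.D (bracket X Y) s p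

/-- `κ` is the curvature of the connection `A`. If locally `∇ = d - i A`, then the curvature
operator is `-i dA`, and `κ` is the function with `dA = κ vol`. For the tangent bundle with the
Levi-Civita connection, `κ` is the Gauss curvature. -/
def MetricConnection.IsCurvature (A : MetricConnection E) (J : S2 → V →ₗ[ℝ] V) (κ : S2 → ℝ) :
    Prop :=
  ∀ X Y s, IsVectorField X → IsVectorField Y → IsSection E s →
    ∀ p, A.curv X Y s p = -(κ p * vol p (X p) (Y p)) • J p (s p)

/-- The hermitian line bundle `(E, J)` has Euler number `n`: there is a metric connection on it, and
every metric connection on it has a smooth curvature function `κ`, and `(1 / 2π) ∫ κ = n`. -/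
def HasEulerNumber (E : S2 → Submodule ℝ V) (J : S2 → V →ₗ[ℝ] V) (n : ℤ) : Prop :=
  IsHermitianLineBundle E J ∧ Nonempty (MetricConnection E) ∧
    ∀ A : MetricConnection E, ∃ κ : S2 → ℝ, Smooth κ ∧ A.IsCurvature J κ ∧
      (2 * Real.pi)⁻¹ * ∫ p, κ p ∂area = n

end Bundles

/-! ### Symmetric traceless tensors on the sphere -/

/-- The `k`-fold tensor power of `ℝ³`. -/
abbrev Ten (k : ℕ) : Type := ⨂[ℝ] _ : Fin k, R3

namespace Ten

/-- The components of a tensor in the basis `e_{i₁} ⊗ ⋯ ⊗ e_{iₖ}`. The tensor power carries the inner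
product for which this basis is orthonormal, that is,
`⟪v₁ ⊗ ⋯ ⊗ vₖ, w₁ ⊗ ⋯ ⊗ wₖ⟫ = ∏ⱼ ⟪vⱼ, wⱼ⟫`, and this is the inner product of component vectors. -/
def coord (k : ℕ) : Ten k ≃ₗ[ℝ] EuclideanSpace ℝ (Fin k → Fin 3) :=
  (Basis.piTensorProduct (fun _ : Fin k => (EuclideanSpace.basisFun (Fin 3) ℝ).toBasis)).equivFun
    ≪≫ₗ (WithLp.linearEquiv 2 ℝ ((Fin k → Fin 3) → ℝ)).symm

/-- The contraction of the first two indices,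
`v₁ ⊗ v₂ ⊗ v₃ ⊗ ⋯ ⊗ vₖ ↦ ⟪v₁, v₂⟫ • v₃ ⊗ ⋯ ⊗ vₖ` with `k = m + 2`. -/
def tr (m : ℕ) : Ten (m + 2) →ₗ[ℝ] Ten m :=
  PiTensorProduct.lift
    { toFun := fun v => ⟪v 0, v 1⟫ • PiTensorProduct.tprod ℝ (fun i : Fin m => v i.succ.succ)
      map_update_add' := by
        intro inst v i x y
        obtain rfl : inst = instDecidableEqFin _ := Subsingleton.elim _ _
        refine Fin.cases ?_ (fun i => Fin.cases ?_ (fun i => ?_) i) i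
        · simp [Function.update, Fin.ext_iff, inner_add_left, add_smul]
        · simp [Function.update, Fin.ext_iff, inner_add_right, add_smul]
        · have h : ∀ z : R3, (fun l : Fin m => Function.update v i.succ.succ z l.succ.succ) =
              Function.update (fun l : Fin m => v l.succ.succ) i z := by
            intro z; funext l; simp [Function.update]
          have h0 : ∀ z : R3, Function.update v i.succ.succ z 0 = v 0 := fun z => by
            simp [Function.update, Fin.ext_iff]
          have h1 : ∀ z : R3, Function.update v i.succ.succ z 1 = v 1 := fun z => by
            simp [Function.update, Fin.ext_iff]
          simp only [h, h0, h1, MultilinearMap.map_update_add, smul_add]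
      map_update_smul' := by
        intro inst v i c x
        obtain rfl : inst = instDecidableEqFin _ := Subsingleton.elim _ _
        refine Fin.cases ?_ (fun i => Fin.cases ?_ (fun i => ?_) i) i
        · simp [Function.update, Fin.ext_iff, inner_smul_left, mul_smul]
        · simp [Function.update, Fin.ext_iff, inner_smul_right, mul_smul]
        · have h : ∀ z : R3, (fun l : Fin m => Function.update v i.succ.succ z l.succ.succ) =
              Function.update (fun l : Fin m => v l.succ.succ) i z := by
            intro z; funext l; simp [Function.update]
          have h0 : ∀ z : R3, Function.update v i.succ.succ z 0 = v 0 := fun z => by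
            simp [Function.update, Fin.ext_iff]
          have h1 : ∀ z : R3, Function.update v i.succ.succ z 1 = v 1 := fun z => by
            simp [Function.update, Fin.ext_iff]
          simp only [h, h0, h1, MultilinearMap.map_update_smul, smul_comm c] }

/-- The tensors all of whose factors are tangent to the sphere at `p`: the tensor power
`⊗ᵏ T_p S²` inside `⊗ᵏ ℝ³`. -/
def tangent (k : ℕ) (p : S2) : Submodule ℝ (Ten k) :=
  LinearMap.range (PiTensorProduct.map (fun _ : Fin k => (S2.tangent p).subtype))

/-- The tensors that are invariant under all permutations of the factors. -/
def symmetric (k : ℕ) : Submodule ℝ (Ten k) :=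
  ⨅ σ : Equiv.Perm (Fin k),
    LinearMap.eqLocus (PiTensorProduct.reindex ℝ (fun _ : Fin k => R3) σ).toLinearMap LinearMap.id

/-- The tensors with vanishing contraction of the first two indices (no condition if `k < 2`). On
tensors tangent to the sphere this is the trace for the metric of the tangent plane. -/
def traceless : (k : ℕ) → Submodule ℝ (Ten k)
  | 0 => ⊤
  | 1 => ⊤
  | m + 2 => LinearMap.ker (tr m)

/-- The rotation by the angle `π / 2` in the first tensor factor, `j ⊗ 1 ⊗ ⋯ ⊗ 1`. -/
def rotFirst (k : ℕ) (p : S2) : Ten k →ₗ[ℝ] Ten k :=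
  PiTensorProduct.map (fun i : Fin k => if (i : ℕ) = 0 then S2.rot p else LinearMap.id)

end Ten

/-- The bundle of symmetric traceless rank-`k` tensors over the sphere: the fibre over `p` is the
space of symmetric traceless tensors in `⊗ᵏ T_p S²`, written in components. -/
def symTrBundle (k : ℕ) (p : S2) : Submodule ℝ (EuclideanSpace ℝ (Fin k → Fin 3)) :=
  (Ten.tangent k p ⊓ Ten.symmetric k ⊓ Ten.traceless k).map (Ten.coord k).toLinearMap

/-- The complex structure of the bundle of symmetric traceless rank-`k` tensors: multiplication by
`i` rotates the first tensor factor (or any other one) by `π / 2` in the positive direction. In a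
positively oriented orthonormal frame `(e₁, e₂)` it maps `Im (e₂ + i e₁)^{⊗ k}` to
`Re (e₂ + i e₁)^{⊗ k}`; these two tensors span the fibre, and the rotation of the tangent plane by
the angle `α` acts on the fibre as `cos (k α) + sin (k α) J`. -/
def symTrJ (k : ℕ) (p : S2) :
    EuclideanSpace ℝ (Fin k → Fin 3) →ₗ[ℝ] EuclideanSpace ℝ (Fin k → Fin 3) :=
  (Ten.coord k).toLinearMap ∘ₗ Ten.rotFirst k p ∘ₗ (Ten.coord k).symm.toLinearMap

end

noncomputable section

/-! ### Calculus on the sphere -/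

namespace S2

variable {W W₁ W₂ : Type*} [NormedAddCommGroup W] [NormedSpace ℝ W] [NormedAddCommGroup W₁]
  [NormedSpace ℝ W₁] [NormedAddCommGroup W₂] [NormedSpace ℝ W₂]

/-! Let `R_j` be the infinitesimal rotation `p × ·` of the `j`-th tensor factor and `ρ` the sum of
all `R_j`. A tensor is tangent to the sphere iff `R_j² = -1` for every `j`, and a tangent tensor is
symmetric and traceless iff all `R_j` agree on it. Together this says `R_i R_j = -1` for all `i, j`
(`TenComp.symTrBundle_eq_fibre`), a polynomial condition in `p` that is easy to differentiate; the
complex structure `J` is any `R_j`. The fibre consists of the tensors `Re (z n^{⊗k})`, where `n = v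
- i (p × v)` is a null eigenvector of `p × ·`.

The rotation about `p × X` moves `p` with velocity `X`. Hence `∇_X s = D_X s - ρ(p × X) s` preserves
the fibres, and it is metric because `ρ` is skew (`TenComp.rotConnection`). Since `ρ` represents the
Lie algebra `(ℝ³, ×)` and `ρ(p) = k J` on the fibre, the curvature of this connection is the
constant `k`. The area `4π` then gives `4πk / 2π = 2k`.

Any other metric connection differs from this one by `⟨b, X⟩ J` for a smooth field `b`
(`MetricConnection.exists_oneForm`), which changes the curvature to `k - normalCurl b`
(`TenComp.curv_eq`). This correction has integral zero: it is a sum of derivatives of the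
coordinates of `b` along the rotation fields `e_c × p`, and rotations preserve area
(`S2.integral_dirDeriv_skew`). The latter is integration by parts in `ℝ³`, transferred to the sphere
by polar coordinates. -/

theorem finrank_R3_fact : Fact (Module.finrank ℝ R3 = 2 + 1) := ⟨finrank_euclideanSpace_fin⟩

attribute [local instance] finrank_R3_fact

theorem coe_ne_zero (p : S2) : (p : R3) ≠ 0 := ne_zero_of_mem_unit_sphere p

theorem norm_coe (p : S2) : ‖(p : R3)‖ = 1 := by simp

theorem coe_retract {x : R3} (hx : x ≠ 0) : (retract x : R3) = ‖x‖⁻¹ • x := by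
  simp [retract, hx]

theorem retract_coe (p : S2) : retract (p : R3) = p := by
  apply Subtype.ext
  rw [coe_retract (coe_ne_zero p), norm_coe]
  simp

theorem retract_smul {c : ℝ} (hc : 0 < c) (x : R3) : retract (c • x) = retract x := by
  by_cases hx : x = 0
  · simp [hx]
  · apply Subtype.ext
    rw [coe_retract (smul_ne_zero hc.ne' hx), coe_retract hx, norm_smul, smul_smul,
      Real.norm_of_nonneg hc.le, mul_inv, mul_right_comm, inv_mul_cancel₀ hc.ne', one_mul]

theorem contMDiffAt_retract {x : R3} (hx : x ≠ 0) :
    ContMDiffAt 𝓘(ℝ, R3) (𝓡 2) ∞ retract x := by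
  let U : TopologicalSpace.Opens R3 := ⟨{0}ᶜ, isOpen_compl_singleton⟩
  have h : ContMDiff 𝓘(ℝ, R3) (𝓡 2) ∞ (fun y : U => retract y) := by
    have h1 : ContMDiff 𝓘(ℝ, R3) 𝓘(ℝ, R3) ∞ (fun y : U => ‖(y : R3)‖⁻¹ • (y : R3)) := by
      intro y
      have hy : (y : R3) ≠ 0 := y.2
      have h2 : ContDiffAt ℝ ∞ (fun z : R3 => ‖z‖⁻¹ • z) y :=
        ((contDiffAt_norm ℝ hy).inv (norm_ne_zero_iff.2 hy)).smul contDiffAt_id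
      exact contMDiffAt_subtype_iff.2 h2.contMDiffAt
    have h3 := h1.codRestrict_sphere (n := 2) (fun y => by
      have hy : (y : R3) ≠ 0 := y.2
      simp [norm_smul, hy])
    refine h3.congr fun y => Subtype.ext ?_
    exact coe_retract y.2
  exact contMDiffAt_subtype_iff.1 (h ⟨x, hx⟩)

theorem Smooth.contDiffAt {f : S2 → W} (hf : Smooth f) {x : R3} (hx : x ≠ 0) :
    ContDiffAt ℝ ∞ (fun y => f (retract y)) x :=
  ((hf (retract x)).comp x (contMDiffAt_retract hx)).contDiffAt

theorem smooth_comp_coe {F : R3 → W} (hF : ∀ p : S2, ContDiffAt ℝ ∞ F (p : R3)) :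
    Smooth (fun p : S2 => F p) := fun p =>
  (hF p).contMDiffAt.comp p (contMDiff_coe_sphere (n := 2) p)

theorem smooth_const (c : W) : Smooth (fun _ => c) := contMDiff_const

theorem smooth_coe : Smooth (fun p : S2 => (p : R3)) := contMDiff_coe_sphere (n := 2)

theorem Smooth.clm (L : W₁ →L[ℝ] W) {f : S2 → W₁} (hf : Smooth f) : Smooth (fun p => L (f p)) :=
  L.contDiff.contMDiff.comp hf

theorem Smooth.bilin (L : W₁ →L[ℝ] W₂ →L[ℝ] W) {f : S2 → W₁} {g : S2 → W₂} (hf : Smooth f)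
    (hg : Smooth g) : Smooth (fun p => L (f p) (g p)) := by
  have h := smooth_comp_coe (F := fun x => L (f (retract x)) (g (retract x))) fun p =>
    (L.contDiff.comp_contDiffAt (p : R3) (hf.contDiffAt (coe_ne_zero p))).clm_apply
      (hg.contDiffAt (coe_ne_zero p))
  simpa only [retract_coe] using h

theorem Smooth.add {f g : S2 → W} (hf : Smooth f) (hg : Smooth g) : Smooth (fun p => f p + g p) :=
  ContMDiff.add hf hg

theorem Smooth.sub {f g : S2 → W} (hf : Smooth f) (hg : Smooth g) : Smooth (fun p => f p - g p) :=
  ContMDiff.sub hf hg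

theorem Smooth.sum {ι : Type*} (s : Finset ι) {f : ι → S2 → W} (hf : ∀ i, Smooth (f i)) :
    Smooth (fun p => ∑ i ∈ s, f i p) := by
  classical
  induction s using Finset.induction_on with
  | empty => simpa using smooth_const (0 : W)
  | insert i s hi ih => simpa only [Finset.sum_insert hi] using (hf i).add ih

theorem Smooth.neg {f : S2 → W} (hf : Smooth f) : Smooth (fun p => -f p) := ContMDiff.neg hf

theorem Smooth.smul {f : S2 → ℝ} {g : S2 → W} (hf : Smooth f) (hg : Smooth g) :
    Smooth (fun p => f p • g p) := hf.bilin (ContinuousLinearMap.lsmul ℝ ℝ) hg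

theorem Smooth.inner {V : Type*} [NormedAddCommGroup V] [InnerProductSpace ℝ V] {f g : S2 → V}
    (hf : Smooth f) (hg : Smooth g) : Smooth (fun p => ⟪f p, g p⟫) := hf.bilin (innerSL ℝ) hg

theorem Smooth.continuous {f : S2 → W} (hf : Smooth f) : Continuous f := ContMDiff.continuous hf

theorem Smooth.hasFDerivAt {f : S2 → W} (hf : Smooth f) {x : R3} (hx : x ≠ 0) :
    HasFDerivAt (fun y => f (retract y)) (fderiv ℝ (fun y => f (retract y)) x) x :=
  ((hf.contDiffAt hx).differentiableAt (by simp)).hasFDerivAt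

theorem dirDeriv_eq {f : S2 → W} {p : S2} {L : R3 →L[ℝ] W}
    (h : HasFDerivAt (fun y => f (retract y)) L (p : R3)) (v : R3) : dirDeriv f p v = L v := by
  rw [dirDeriv, h.fderiv]

theorem dirDeriv_add_right (f : S2 → W) (p : S2) (v w : R3) :
    dirDeriv f p (v + w) = dirDeriv f p v + dirDeriv f p w := map_add _ _ _

theorem dirDeriv_smul_right (f : S2 → W) (p : S2) (c : ℝ) (v : R3) :
    dirDeriv f p (c • v) = c • dirDeriv f p v := map_smul _ _ _

theorem dirDeriv_sub_right (f : S2 → W) (p : S2) (v w : R3) :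
    dirDeriv f p (v - w) = dirDeriv f p v - dirDeriv f p w := map_sub _ _ _

theorem dirDeriv_const (c : W) (p : S2) (v : R3) : dirDeriv (fun _ => c) p v = 0 := by
  simp [dirDeriv]

theorem dirDeriv_clm (L : W₁ →L[ℝ] W) {f : S2 → W₁} (hf : Smooth f) (p : S2) (v : R3) :
    dirDeriv (fun q => L (f q)) p v = L (dirDeriv f p v) :=
  dirDeriv_eq (f := fun q => L (f q)) (L.hasFDerivAt.comp _ (hf.hasFDerivAt (coe_ne_zero p))) v

theorem dirDeriv_bilin (L : W₁ →L[ℝ] W₂ →L[ℝ] W) {f : S2 → W₁} {g : S2 → W₂} (hf : Smooth f)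
    (hg : Smooth g) (p : S2) (v : R3) :
    dirDeriv (fun q => L (f q) (g q)) p v = L (dirDeriv f p v) (g p) + L (f p) (dirDeriv g p v) := by
  have h := L.hasFDerivAt_of_bilinear (hf.hasFDerivAt (coe_ne_zero p))
    (hg.hasFDerivAt (coe_ne_zero p))
  rw [dirDeriv_eq (f := fun q => L (f q) (g q)) h]
  simp [retract_coe, dirDeriv, add_comm]

theorem dirDeriv_add {f g : S2 → W} (hf : Smooth f) (hg : Smooth g) (p : S2) (v : R3) :
    dirDeriv (fun q => f q + g q) p v = dirDeriv f p v + dirDeriv g p v :=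
  dirDeriv_eq (f := fun q => f q + g q)
    ((hf.hasFDerivAt (coe_ne_zero p)).add (hg.hasFDerivAt (coe_ne_zero p))) v

theorem dirDeriv_sub {f g : S2 → W} (hf : Smooth f) (hg : Smooth g) (p : S2) (v : R3) :
    dirDeriv (fun q => f q - g q) p v = dirDeriv f p v - dirDeriv g p v :=
  dirDeriv_eq (f := fun q => f q - g q)
    ((hf.hasFDerivAt (coe_ne_zero p)).sub (hg.hasFDerivAt (coe_ne_zero p))) v

theorem dirDeriv_neg {f : S2 → W} (hf : Smooth f) (p : S2) (v : R3) :
    dirDeriv (fun q => -f q) p v = -dirDeriv f p v :=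
  dirDeriv_eq (f := fun q => -f q) (hf.hasFDerivAt (coe_ne_zero p)).neg v

theorem dirDeriv_smul {f : S2 → ℝ} {g : S2 → W} (hf : Smooth f) (hg : Smooth g) (p : S2) (v : R3) :
    dirDeriv (fun q => f q • g q) p v = dirDeriv f p v • g p + f p • dirDeriv g p v :=
  dirDeriv_bilin (ContinuousLinearMap.lsmul ℝ ℝ) hf hg p v

theorem dirDeriv_inner {V : Type*} [NormedAddCommGroup V] [InnerProductSpace ℝ V] {f g : S2 → V}
    (hf : Smooth f) (hg : Smooth g) (p : S2) (v : R3) :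
    dirDeriv (fun q => ⟪f q, g q⟫) p v = ⟪dirDeriv f p v, g p⟫ + ⟪f p, dirDeriv g p v⟫ :=
  dirDeriv_bilin (innerSL ℝ) hf hg p v

theorem mem_tangent_iff {p : S2} {v : R3} : v ∈ tangent p ↔ ⟪(p : R3), v⟫ = 0 :=
  Submodule.mem_orthogonal_singleton_iff_inner_right

/-- The differential of the radial retraction at a point of the sphere is the orthogonal projection
to the tangent plane. Hence tangential derivatives do not depend on how a function is extended off
the sphere. -/
theorem hasFDerivAt_coe_retract (p : S2) :
    HasFDerivAt (fun x => (retract x : R3))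
      (ContinuousLinearMap.id ℝ R3 - (innerSL ℝ (p : R3)).smulRight (p : R3)) (p : R3) := by
  have hne := coe_ne_zero p
  have h1 : HasFDerivAt (fun x : R3 => ‖x‖ ^ 2) (2 • innerSL ℝ (p : R3)) (p : R3) :=
    (hasStrictFDerivAt_norm_sq _).hasFDerivAt
  have h2 := (hasDerivAt_inv (x := √(‖(p : R3)‖ ^ 2)) (by simp)).comp_hasFDerivAt (p : R3)
    (h1.sqrt (by simp))
  have h3 := h2.smul (hasFDerivAt_id (p : R3))
  have h4 := h3.congr_of_eventuallyEq (f₁ := fun x => (retract x : R3)) (by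
    filter_upwards [isOpen_ne.mem_nhds hne] with x hx
    simp [coe_retract hx])
  refine h4.congr_fderiv (ContinuousLinearMap.ext fun v => ?_)
  simp [sub_eq_add_neg]

theorem dirDeriv_coe {p : S2} {v : R3} (hv : v ∈ tangent p) :
    dirDeriv (fun q : S2 => (q : R3)) p v = v := by
  rw [dirDeriv_eq (f := fun q : S2 => (q : R3)) (hasFDerivAt_coe_retract p)]
  simp [mem_tangent_iff.1 hv]

theorem Smooth.contDiffAt_fderiv {f : S2 → W} (hf : Smooth f) {x : R3} (hx : x ≠ 0) :
    ContDiffAt ℝ ∞ (fderiv ℝ (fun y => f (retract y))) x :=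
  (hf.contDiffAt hx).fderiv_right (by simp)

theorem Smooth.smooth_fderiv {f : S2 → W} (hf : Smooth f) :
    Smooth (fun p : S2 => fderiv ℝ (fun y => f (retract y)) (p : R3)) :=
  smooth_comp_coe fun p => hf.contDiffAt_fderiv (coe_ne_zero p)

theorem Smooth.dirDeriv {f : S2 → W} (hf : Smooth f) {X : S2 → R3} (hX : Smooth X) :
    Smooth (fun p => dirDeriv f p (X p)) :=
  hf.smooth_fderiv.bilin (ContinuousLinearMap.id ℝ (R3 →L[ℝ] W)) hX

/-- This isolates the Hessian of the radial extension, whose symmetry is what makes second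
derivatives commute up to the bracket. -/
theorem dirDeriv_dirDeriv {f : S2 → W} (hf : Smooth f) {Y : S2 → R3} (hY : Smooth Y) (p : S2)
    {v : R3} (hv : v ∈ tangent p) :
    S2.dirDeriv (fun q => S2.dirDeriv f q (Y q)) p v =
      fderiv ℝ (fderiv ℝ (fun y => f (retract y))) (p : R3) v (Y p) +
        S2.dirDeriv f p (S2.dirDeriv Y p v) := by
  have h := dirDeriv_bilin (ContinuousLinearMap.id ℝ (R3 →L[ℝ] W)) hf.smooth_fderiv hY p v
  simp only [ContinuousLinearMap.coe_id', id_eq] at h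
  refine h.trans (congrArg₂ _ (congrArg (fun L : R3 →L[ℝ] W => L (Y p)) ?_) rfl)
  have h1 : HasFDerivAt (fderiv ℝ (fun y => f (retract y)))
      (fderiv ℝ (fderiv ℝ (fun y => f (retract y))) (p : R3)) ((retract (p : R3) : S2) : R3) := by
    rw [retract_coe]
    exact ((hf.contDiffAt_fderiv (coe_ne_zero p)).differentiableAt (by simp)).hasFDerivAt
  have h2 := h1.comp (p : R3) (hasFDerivAt_coe_retract p)
  rw [dirDeriv_eq (f := fun q : S2 => fderiv ℝ (fun y => f (retract y)) (q : R3)) h2]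
  simp [mem_tangent_iff.1 hv]

theorem dirDeriv_bracket {f : S2 → W} (hf : Smooth f) {X Y : S2 → R3} (hX : IsVectorField X)
    (hY : IsVectorField Y) (p : S2) :
    S2.dirDeriv f p (bracket X Y p) = S2.dirDeriv (fun q => S2.dirDeriv f q (Y q)) p (X p) -
      S2.dirDeriv (fun q => S2.dirDeriv f q (X q)) p (Y p) := by
  have hs : IsSymmSndFDerivAt ℝ (fun y => f (retract y)) (p : R3) :=
    (hf.contDiffAt (coe_ne_zero p)).isSymmSndFDerivAt (by
      rw [minSmoothness_of_isRCLikeNormedField]; exact WithTop.coe_le_coe.2 le_top)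
  rw [dirDeriv_dirDeriv hf hY.1 p (hX.2 p), dirDeriv_dirDeriv hf hX.1 p (hY.2 p),
    hs.eq (X p) (Y p), bracket, dirDeriv_sub_right]
  abel

/-- Differentiate `⟨q, X q⟩ = 0`. The normal component is symmetric in the two fields when `v` is
the value of the second, so it drops out of the bracket. -/
theorem inner_dirDeriv_of_tangent {X : S2 → R3} (hX : IsVectorField X) {p : S2} {v : R3}
    (hv : v ∈ tangent p) : ⟪(p : R3), S2.dirDeriv X p v⟫ = -⟪v, X p⟫ := by
  have h := dirDeriv_inner smooth_coe hX.1 p v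
  have h0 : (fun q : S2 => ⟪(q : R3), X q⟫) = fun _ => 0 :=
    funext fun q => mem_tangent_iff.1 (hX.2 q)
  rw [h0, dirDeriv_const, dirDeriv_coe hv] at h
  linarith

theorem IsVectorField.bracket {X Y : S2 → R3} (hX : IsVectorField X) (hY : IsVectorField Y) :
    IsVectorField (bracket X Y) := by
  refine ⟨(hY.1.dirDeriv hX.1).sub (hX.1.dirDeriv hY.1), fun p => mem_tangent_iff.2 ?_⟩
  rw [S2.bracket, inner_sub_right, inner_dirDeriv_of_tangent hY (hX.2 p),
    inner_dirDeriv_of_tangent hX (hY.2 p), real_inner_comm]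
  ring

end S2

/-! ### Integration over the sphere -/

namespace S2

open MeasureTheory

/-- Polar coordinates: the bridge between integrals over the sphere and integrals over `ℝ³`. -/
theorem integral_norm_mul_retract (ψ : ℝ → ℝ) (g : S2 → ℝ) :
    ∫ x : R3, ψ ‖x‖ * g (retract x) =
      (∫ p, g p ∂area) * ∫ r : Set.Ioi (0 : ℝ), ψ r ∂(Measure.volumeIoiPow 2) := by
  have hdim : Module.finrank ℝ R3 - 1 = 2 := by simp
  have h := (volume : Measure R3).measurePreserving_homeomorphUnitSphereProd.integral_comp
    (Homeomorph.measurableEmbedding _) (fun q : S2 × Set.Ioi (0 : ℝ) => g q.1 * ψ q.2)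
  rw [hdim, integral_prod_mul g (fun r : Set.Ioi (0 : ℝ) => ψ r)] at h
  rw [area, ← h, ← restrict_compl_singleton (μ := (volume : Measure R3)) 0,
    ← integral_subtype_comap (measurableSet_singleton (0 : R3)).compl
      fun x => ψ ‖x‖ * g (retract x), restrict_compl_singleton]
  refine integral_congr_ae (.of_forall fun x => ?_)
  have hx : (x : R3) ≠ 0 := x.2
  have h1 : (homeomorphUnitSphereProd R3 x).1 = retract (x : R3) :=
    Subtype.ext (by rw [coe_retract hx, homeomorphUnitSphereProd_apply_fst_coe])
  simp only [h1, homeomorphUnitSphereProd_apply_snd_coe, mul_comm]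

theorem area_real_univ : area.real Set.univ = 4 * Real.pi := by
  rw [area, Measure.toSphere_real_apply_univ, measureReal_def, EuclideanSpace.volume_ball_fin_three]
  have := Real.pi_pos.le
  simp [ENNReal.toReal_ofReal (by positivity : 0 ≤ Real.pi * 4 / 3)]
  ring

instance : IsFiniteMeasure area := inferInstanceAs (IsFiniteMeasure (Measure.toSphere _))

theorem Smooth.integrable {f : S2 → ℝ} (hf : Smooth f) : Integrable f area :=
  hf.continuous.integrable_of_hasCompactSupport (HasCompactSupport.of_compactSpace f)

/-- A smooth bump on the line around `1` which vanishes near `0`. -/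
def annulusBump : ContDiffBump (1 : ℝ) := ⟨1 / 4, 1 / 2, by norm_num, by norm_num⟩

theorem annulusBump_eq_zero {t : ℝ} (ht : t ≤ 1 / 2 ∨ 3 / 2 ≤ t) : annulusBump t = 0 := by
  apply annulusBump.zero_of_le_dist
  rw [Real.dist_eq]
  change (1 / 2 : ℝ) ≤ _
  rcases ht with h | h
  · rw [abs_of_nonpos] <;> linarith
  · rw [abs_of_nonneg] <;> linarith

theorem annulusBump_sq_norm_eventuallyEq : (fun x : R3 => annulusBump (‖x‖ ^ 2)) =ᶠ[nhds 0] 0 := by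
  have : ContinuousAt (fun x : R3 => ‖x‖ ^ 2) 0 := by fun_prop
  filter_upwards [this.eventually (Iio_mem_nhds (show ‖(0 : R3)‖ ^ 2 < 1 / 2 by norm_num))] with x hx
  exact annulusBump_eq_zero (Or.inl hx.le)

theorem hasCompactSupport_annulusBump_sq_norm :
    HasCompactSupport (fun x : R3 => annulusBump (‖x‖ ^ 2)) := by
  refine HasCompactSupport.of_support_subset_isCompact (isCompact_closedBall (0 : R3) 2) fun x hx => ?_
  rw [mem_closedBall_zero_iff]
  by_contra! h
  exact hx (annulusBump_eq_zero (Or.inr (by nlinarith)))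

theorem contDiff_annulusBump_sq_norm : ContDiff ℝ ∞ (fun x : R3 => annulusBump (‖x‖ ^ 2)) :=
  annulusBump.contDiff.comp (contDiff_norm_sq ℝ)

theorem integral_annulusBump_ne_zero :
    ∫ r : Set.Ioi (0 : ℝ), annulusBump ((r : ℝ) ^ 2) ∂(Measure.volumeIoiPow 2) ≠ 0 := by
  intro h0
  have h := integral_norm_mul_retract (fun r => annulusBump (r ^ 2)) (fun _ => 1)
  rw [h0, mul_zero] at h
  simp only [mul_one] at h
  have hpos : 0 < ∫ x : R3, annulusBump (‖x‖ ^ 2) := by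
    refine contDiff_annulusBump_sq_norm.continuous.integral_pos_of_hasCompactSupport_nonneg_nonzero
      hasCompactSupport_annulusBump_sq_norm (fun x => annulusBump.nonneg)
      (x := EuclideanSpace.single 0 1) ?_
    have : annulusBump (‖(EuclideanSpace.single 0 1 : R3)‖ ^ 2) = 1 := by
      apply annulusBump.one_of_mem_closedBall
      simp [annulusBump]
    rw [this]
    exact one_ne_zero
  exact hpos.ne' h

/-- The radial extension is homogeneous of degree zero, so its differential has degree `-1`, which
the scaling of `v` compensates. -/
theorem fderiv_retract_smul {W : Type*} [NormedAddCommGroup W] [NormedSpace ℝ W] {f : S2 → W}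
    (hf : Smooth f) {c : ℝ} (hc : 0 < c) {x : R3} (hx : x ≠ 0) (v : R3) :
    fderiv ℝ (fun y => f (retract y)) (c • x) (c • v) = fderiv ℝ (fun y => f (retract y)) x v := by
  have h1 := (hf.hasFDerivAt (smul_ne_zero hc.ne' hx)).comp x
    ((hasFDerivAt_id (𝕜 := ℝ) x).const_smul c)
  have h2 : (fun y => f (retract y)) ∘ (HSMul.hSMul c) = fun y => f (retract y) :=
    funext fun y => congrArg f (retract_smul hc y)
  rw [h2] at h1
  rw [h1.fderiv]
  simp

/-- The divergence theorem for a skew linear vector field and a compactly supported function. -/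
theorem integral_fderiv_skew {G : R3 → ℝ} (hG : ContDiff ℝ ∞ G) (hc : HasCompactSupport G)
    (A : R3 →L[ℝ] R3) (hA : ∀ x, ⟪A x, x⟫ = 0) : ∫ x, fderiv ℝ G x (A x) = 0 := by
  let e : Fin 3 → R3 := fun c => EuclideanSpace.single c 1
  let a : Fin 3 → R3 →L[ℝ] ℝ := fun c => (EuclideanSpace.proj c).comp A
  have hdG : Continuous (fderiv ℝ G) := hG.continuous_fderiv (by simp)
  have hcd : HasCompactSupport (fderiv ℝ G) := hc.fderiv ℝ
  have key : ∀ c, Integrable (fun x => a c x * fderiv ℝ G x (e c)) ∧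
      ∫ x, a c x * fderiv ℝ G x (e c) = 0 := by
    intro c
    -- By skewness the `c`-th component of the field does not depend on the `c`-th coordinate, so
    -- integrating by parts in that direction leaves nothing.
    have hcc : a c (e c) = 0 := by
      have := hA (e c)
      simpa [e, a, EuclideanSpace.inner_single_right] using this
    have hi1 : Integrable (fun x => a c x * fderiv ℝ G x (e c)) := by
      refine Continuous.integrable_of_hasCompactSupport
        ((a c).continuous.mul (hdG.clm_apply continuous_const)) ?_
      refine HasCompactSupport.mul_left (f' := fun x => fderiv ℝ G x (e c)) ?_
      exact hcd.comp_left (g := fun L : R3 →L[ℝ] ℝ => L (e c)) rfl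
    have hi2 : Integrable (fun x => a c x * G x) :=
      Continuous.integrable_of_hasCompactSupport ((a c).continuous.mul hG.continuous) hc.mul_left
    refine ⟨hi1, ?_⟩
    rw [integral_mul_fderiv_eq_neg_fderiv_mul_of_integrable _ hi1 hi2
      (fun x _ => (a c).differentiableAt) (fun x _ => hG.differentiable (by simp) x)]
    · simp [hcc]
    · simp [hcc]
  have hsum : ∀ x, fderiv ℝ G x (A x) = ∑ c, a c x * fderiv ℝ G x (e c) := by
    intro x
    have : A x = ∑ c, a c x • e c := by
      ext i
      simp [a, e, Finset.sum_apply, Pi.single_apply]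
    conv_lhs => rw [this]
    simp
  simp_rw [hsum]
  rw [integral_finsetSum _ fun c _ => (key c).1]
  exact Finset.sum_eq_zero fun c _ => (key c).2

/-- The derivative of a function along an infinitesimal rotation has vanishing mean. -/
theorem integral_dirDeriv_skew {f : S2 → ℝ} (hf : Smooth f) (A : R3 →L[ℝ] R3)
    (hA : ∀ x, ⟪A x, x⟫ = 0) : ∫ p, dirDeriv f p (A p) ∂area = 0 := by
  -- The cutoff removes the singularity of the radial extension at the origin and makes its support
  -- compact. Being radial, it is constant along the flow of `A`.
  let φ : R3 → ℝ := fun x => annulusBump (‖x‖ ^ 2)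
  let G : R3 → ℝ := fun x => φ x * f (retract x)
  have hG : ContDiff ℝ ∞ G := by
    rw [contDiff_iff_contDiffAt]
    intro x
    by_cases hx : x = 0
    · subst hx
      refine (contDiffAt_const (c := (0 : ℝ))).congr_of_eventuallyEq ?_
      filter_upwards [annulusBump_sq_norm_eventuallyEq] with x hx
      exact (congrArg (· * f (retract x)) hx).trans (zero_mul _)
    · exact contDiff_annulusBump_sq_norm.contDiffAt.mul (hf.contDiffAt hx)
  have h := integral_fderiv_skew hG hasCompactSupport_annulusBump_sq_norm.mul_right A hA
  have hpt : ∀ x, fderiv ℝ G x (A x) =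
      annulusBump (‖x‖ ^ 2) * (fun p : S2 => dirDeriv f p (A p)) (retract x) := by
    intro x
    by_cases hx : x = 0
    · subst hx
      simp [annulusBump_eq_zero (t := 0) (by norm_num)]
    · have h1 : HasFDerivAt φ ((deriv annulusBump (‖x‖ ^ 2)) • (2 • innerSL ℝ x)) x :=
        HasDerivAt.comp_hasFDerivAt (h₂ := annulusBump) x
          ((annulusBump.contDiff (n := 1)).differentiable (by simp) _).hasDerivAt
          (hasStrictFDerivAt_norm_sq x).hasFDerivAt
      have h2 : HasFDerivAt G _ x := h1.mul (hf.hasFDerivAt hx)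
      rw [h2.fderiv]
      -- The gradient of the cutoff is a multiple of `x`, so only the factor `f` contributes to the
      -- derivative along `A x`.
      have h3 : ⟪x, A x⟫ = 0 := by rw [real_inner_comm]; exact hA x
      have h4 : fderiv ℝ (fun y => f (retract y)) x (A x) =
          dirDeriv f (retract x) (A (retract x)) := by
        rw [dirDeriv, coe_retract hx, map_smul,
          fderiv_retract_smul hf (inv_pos.2 (norm_pos_iff.2 hx)) hx]
      simp [h3, h4, φ]
  simp_rw [hpt] at h
  rw [integral_norm_mul_retract (fun r => annulusBump (r ^ 2))
    (fun p : S2 => dirDeriv f p (A p))] at h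
  exact (mul_eq_zero.1 h).resolve_right integral_annulusBump_ne_zero

end S2

/-! ### The cross product -/

/-- The cross product of Euclidean three-space as a continuous bilinear map. -/
def crossL : R3 →L[ℝ] R3 →L[ℝ] R3 :=
  LinearMap.toContinuousBilinearMap
    ((crossProduct (R := ℝ)).compl₁₂ (WithLp.linearEquiv 2 ℝ (Fin 3 → ℝ)).toLinearMap
      (WithLp.linearEquiv 2 ℝ (Fin 3 → ℝ)).toLinearMap |>.compr₂
        (WithLp.linearEquiv 2 ℝ (Fin 3 → ℝ)).symm.toLinearMap)

theorem crossL_zero (a b : R3) : crossL a b 0 = a 1 * b 2 - a 2 * b 1 := rfl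

theorem crossL_one (a b : R3) : crossL a b 1 = a 2 * b 0 - a 0 * b 2 := rfl

theorem crossL_two (a b : R3) : crossL a b 2 = a 0 * b 1 - a 1 * b 0 := rfl

theorem R3.inner_eq (a b : R3) : ⟪a, b⟫ = a 0 * b 0 + a 1 * b 1 + a 2 * b 2 := by
  simp [PiLp.inner_apply, Fin.sum_univ_three, mul_comm]

theorem R3.ext {a b : R3} (h0 : a 0 = b 0) (h1 : a 1 = b 1) (h2 : a 2 = b 2) : a = b := by
  ext i; fin_cases i <;> assumption

theorem S2.vol_eq (p : S2) (v w : R3) : S2.vol p v w = ⟪crossL p v, w⟫ := rfl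

theorem inner_crossL_right (a b : R3) : ⟪crossL a b, b⟫ = 0 := by
  rw [R3.inner_eq, crossL_zero, crossL_one, crossL_two]; ring

theorem inner_crossL_left (a b : R3) : ⟪a, crossL a b⟫ = 0 := by
  rw [R3.inner_eq, crossL_zero, crossL_one, crossL_two]; ring

theorem crossL_self (a : R3) : crossL a a = 0 := by
  apply R3.ext <;> simp only [crossL_zero, crossL_one, crossL_two, PiLp.zero_apply] <;> ring

namespace S2

theorem coe_sq (p : S2) : (p : R3) 0 * (p : R3) 0 + (p : R3) 1 * (p : R3) 1 +
    (p : R3) 2 * (p : R3) 2 = 1 := by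
  rw [← R3.inner_eq, real_inner_self_eq_norm_sq, norm_coe, one_pow]

variable {p : S2} {v w : R3}

/-- The infinitesimal rotation about `p × v` moves `p` with velocity `v`; this is what singles out
the connection used below. -/
theorem crossL_crossL_coe (hv : v ∈ tangent p) : crossL (crossL p v) p = v := by
  have h := coe_sq p
  rw [mem_tangent_iff, R3.inner_eq] at hv
  apply R3.ext <;> simp only [crossL_zero, crossL_one, crossL_two]
  · linear_combination v 0 * h - (p : R3) 0 * hv
  · linear_combination v 1 * h - (p : R3) 1 * hv
  · linear_combination v 2 * h - (p : R3) 2 * hv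

theorem crossL_coe_crossL (hv : v ∈ tangent p) : crossL p (crossL p v) = -v := by
  have h := coe_sq p
  rw [mem_tangent_iff, R3.inner_eq] at hv
  apply R3.ext <;> simp only [crossL_zero, crossL_one, crossL_two, PiLp.neg_apply]
  · linear_combination -v 0 * h + (p : R3) 0 * hv
  · linear_combination -v 1 * h + (p : R3) 1 * hv
  · linear_combination -v 2 * h + (p : R3) 2 * hv

theorem crossL_tangent (hv : v ∈ tangent p) (hw : w ∈ tangent p) :
    crossL v w = vol p v w • (p : R3) := by
  have h := coe_sq p
  rw [mem_tangent_iff, R3.inner_eq] at hv hw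
  rw [vol_eq, R3.inner_eq]
  apply R3.ext <;> simp only [crossL_zero, crossL_one, crossL_two, PiLp.smul_apply, smul_eq_mul]
  · linear_combination ((p : R3) 1 * w 2 - (p : R3) 2 * w 1) * hv -
      ((p : R3) 1 * v 2 - (p : R3) 2 * v 1) * hw - (v 1 * w 2 - v 2 * w 1) * h
  · linear_combination ((p : R3) 2 * w 0 - (p : R3) 0 * w 2) * hv -
      ((p : R3) 2 * v 0 - (p : R3) 0 * v 2) * hw - (v 2 * w 0 - v 0 * w 2) * h
  · linear_combination ((p : R3) 0 * w 1 - (p : R3) 1 * w 0) * hv -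
      ((p : R3) 0 * v 1 - (p : R3) 1 * v 0) * hw - (v 0 * w 1 - v 1 * w 0) * h

theorem crossL_crossL_crossL (p : S2) (v w : R3) :
    crossL (crossL p v) (crossL p w) = vol p v w • (p : R3) := by
  rw [vol_eq, R3.inner_eq]
  apply R3.ext <;> simp only [crossL_zero, crossL_one, crossL_two, PiLp.smul_apply, smul_eq_mul] <;>
    ring

theorem inner_crossL_crossL_self (hv : v ∈ tangent p) : ⟪crossL p v, crossL p v⟫ = ⟪v, v⟫ := by
  have h := coe_sq p
  rw [mem_tangent_iff, R3.inner_eq] at hv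
  simp only [R3.inner_eq, crossL_zero, crossL_one, crossL_two]
  linear_combination (v 0 ^ 2 + v 1 ^ 2 + v 2 ^ 2) * h -
    ((p : R3) 0 * v 0 + (p : R3) 1 * v 1 + (p : R3) 2 * v 2) * hv

theorem exists_unit_tangent (p : S2) : ∃ v ∈ tangent p, ⟪v, v⟫ = 1 := by
  have hr : Module.finrank ℝ (tangent p) = 2 := by
    have := finrank_R3_fact
    exact Submodule.finrank_orthogonal_span_singleton (coe_ne_zero p)
  have : Nontrivial (tangent p) := Module.nontrivial_of_finrank_pos (R := ℝ) (by omega)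
  obtain ⟨v, hv⟩ := exists_ne (0 : tangent p)
  have hv' : (v : R3) ≠ 0 := fun h => hv (Subtype.ext h)
  refine ⟨‖(v : R3)‖⁻¹ • (v : R3), Submodule.smul_mem _ _ v.2, ?_⟩
  rw [real_inner_self_eq_norm_sq, norm_smul, norm_inv, norm_norm,
    inv_mul_cancel₀ (norm_ne_zero_iff.2 hv'), one_pow]

theorem eq_sum_of_unit_tangent (hv : v ∈ tangent p) (hn : ⟪v, v⟫ = 1) (x : R3) :
    x = ⟪v, x⟫ • v + ⟪crossL p v, x⟫ • crossL p v + ⟪(p : R3), x⟫ • (p : R3) := by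
  have hon : Orthonormal ℝ ![v, crossL p v, (p : R3)] := by
    have h1 := mem_tangent_iff.1 hv
    have h2 : ⟪v, (p : R3)⟫ = 0 := by rw [real_inner_comm]; exact h1
    have h3 := inner_crossL_right (p : R3) v
    have h4 : ⟪v, crossL p v⟫ = 0 := by rw [real_inner_comm]; exact h3
    have h5 := inner_crossL_left (p : R3) v
    have h6 : ⟪crossL p v, (p : R3)⟫ = 0 := by rw [real_inner_comm]; exact h5
    have h7 : ⟪crossL p v, crossL p v⟫ = 1 := (inner_crossL_crossL_self hv).trans hn
    have h8 : ⟪(p : R3), (p : R3)⟫ = 1 := by rw [real_inner_self_eq_norm_sq, norm_coe, one_pow]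
    have h9 : ‖v‖ = 1 := by rw [norm_eq_sqrt_real_inner, hn, Real.sqrt_one]
    have h10 : ‖crossL p v‖ = 1 := by rw [norm_eq_sqrt_real_inner, h7, Real.sqrt_one]
    rw [orthonormal_iff_ite]
    intro i j
    fin_cases i <;> fin_cases j <;> simp [*]
  let b := OrthonormalBasis.mk hon (by
    rw [LinearIndependent.span_eq_top_of_card_eq_finrank' hon.linearIndependent (by simp)])
  have := b.sum_repr' x
  simp only [b, Fin.sum_univ_three, OrthonormalBasis.coe_mk] at this
  exact this.symm

end S2

/-! ### Operators on the factors of a tensor -/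

/-- Component vectors of tensors of rank `k` over `ℝ³`. -/
abbrev TenComp (k : ℕ) : Type := EuclideanSpace ℝ (Fin k → Fin 3)

namespace TenComp

variable {k : ℕ}

/-- The action of a matrix on the `j`-th index. -/
def slot (j : Fin k) (A : Matrix (Fin 3) (Fin 3) ℝ) (x : TenComp k) : TenComp k :=
  WithLp.toLp 2 fun I => ∑ b, A (I j) b * x (Function.update I j b)

theorem slot_apply (j : Fin k) (A : Matrix (Fin 3) (Fin 3) ℝ) (x : TenComp k) (I : Fin k → Fin 3) :
    slot j A x I = ∑ b, A (I j) b * x (Function.update I j b) := rfl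

theorem slot_slot (j : Fin k) (A B : Matrix (Fin 3) (Fin 3) ℝ) (x : TenComp k) :
    slot j A (slot j B x) = slot j (A * B) x := by
  ext I
  simp only [slot_apply, Function.update_self, Function.update_idem, Matrix.mul_apply,
    Finset.mul_sum, Finset.sum_mul]
  rw [Finset.sum_comm]
  simp only [mul_assoc]

theorem slot_comm {i j : Fin k} (h : i ≠ j) (A B : Matrix (Fin 3) (Fin 3) ℝ) (x : TenComp k) :
    slot i A (slot j B x) = slot j B (slot i A x) := by
  ext I
  simp only [slot_apply, Function.update_of_ne h, Function.update_of_ne h.symm, Finset.mul_sum]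
  rw [Finset.sum_comm]
  refine Finset.sum_congr rfl fun b _ => Finset.sum_congr rfl fun c _ => ?_
  rw [Function.update_comm h]
  ring

theorem inner_slot (j : Fin k) (A : Matrix (Fin 3) (Fin 3) ℝ) (x y : TenComp k) :
    ⟪slot j A x, y⟫ = ⟪x, slot j A.transpose y⟫ := by
  simp only [PiLp.inner_apply, slot_apply, RCLike.inner_apply, conj_trivial, Finset.mul_sum,
    Finset.sum_mul, Matrix.transpose_apply]
  rw [← Finset.sum_product', ← Finset.sum_product']
  -- Exchanging the `j`-th entry of the multi-index with the summation index is an involution of the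
  -- index pairs.
  refine Finset.sum_nbij' (fun q => (Function.update q.1 j q.2, q.1 j))
    (fun q => (Function.update q.1 j q.2, q.1 j)) ?_ ?_ ?_ ?_ ?_
  · simp
  · simp
  · rintro ⟨I, b⟩ -; simp
  · rintro ⟨I, b⟩ -; simp
  · rintro ⟨I, b⟩ -; simp; ring

/-- The matrix of the cross product with `a`. -/
def crossMat (a : R3) : Matrix (Fin 3) (Fin 3) ℝ :=
  !![0, -a 2, a 1; a 2, 0, -a 0; -a 1, a 0, 0]

theorem crossMat_mul_sub (a b : R3) :
    crossMat a * crossMat b - crossMat b * crossMat a = crossMat (crossL a b) := by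
  ext i j
  fin_cases i <;> fin_cases j <;>
    simp [crossMat, crossL_zero, crossL_one, crossL_two] <;> ring

theorem sum_crossMat_mul (a v : R3) (i : Fin 3) : ∑ b, crossMat a i b * v b = crossL a v i := by
  fin_cases i <;>
    simp [crossMat, Fin.sum_univ_three, crossL_zero, crossL_one, crossL_two] <;> ring

/-- The infinitesimal rotation about `a` of the `j`-th tensor factor. -/
def rotSlot (j : Fin k) : R3 →L[ℝ] TenComp k →L[ℝ] TenComp k :=
  LinearMap.toContinuousBilinearMap <| LinearMap.mk₂ ℝ (fun a x => slot j (crossMat a) x)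
    (fun a b x => by
      ext I
      simp only [slot_apply, PiLp.add_apply, ← Finset.sum_add_distrib, ← add_mul]
      refine Finset.sum_congr rfl fun c _ => congrArg (· * _) ?_
      generalize I j = i
      fin_cases i <;> fin_cases c <;> simp [crossMat] <;> ring)
    (fun r a x => by
      ext I
      simp only [slot_apply, PiLp.smul_apply, smul_eq_mul, Finset.mul_sum, ← mul_assoc]
      refine Finset.sum_congr rfl fun c _ => congrArg (· * _) ?_
      generalize I j = i
      fin_cases i <;> fin_cases c <;> simp [crossMat])
    (fun a x y => by
      ext I
      simp only [slot_apply, PiLp.add_apply, ← Finset.sum_add_distrib, ← mul_add])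
    (fun r a x => by
      ext I
      simp only [slot_apply, PiLp.smul_apply, smul_eq_mul, Finset.mul_sum]
      exact Finset.sum_congr rfl fun c _ => by ring)

theorem rotSlot_eq (j : Fin k) (a : R3) (x : TenComp k) : rotSlot j a x = slot j (crossMat a) x :=
  rfl

theorem rotSlot_apply (j : Fin k) (a : R3) (x : TenComp k) (I : Fin k → Fin 3) :
    rotSlot j a x I = ∑ b, crossMat a (I j) b * x (Function.update I j b) := rfl

theorem rotSlot_comm {i j : Fin k} (h : i ≠ j) (a b : R3) (x : TenComp k) :
    rotSlot i a (rotSlot j b x) = rotSlot j b (rotSlot i a x) := slot_comm h _ _ x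

theorem rotSlot_lie (j : Fin k) (a b : R3) (x : TenComp k) :
    rotSlot j a (rotSlot j b x) = rotSlot j b (rotSlot j a x) + rotSlot j (crossL a b) x := by
  simp only [rotSlot_eq, slot_slot, ← crossMat_mul_sub]
  ext I
  simp only [slot_apply, PiLp.add_apply, ← Finset.sum_add_distrib, Matrix.sub_apply]
  exact Finset.sum_congr rfl fun c _ => by ring

theorem inner_rotSlot (j : Fin k) (a : R3) (x y : TenComp k) :
    ⟪rotSlot j a x, y⟫ = -⟪x, rotSlot j a y⟫ := by
  have h : (crossMat a).transpose = crossMat (-a) := by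
    ext i j
    fin_cases i <;> fin_cases j <;> simp [crossMat]
  rw [rotSlot_eq, inner_slot, h, ← rotSlot_eq, map_neg, neg_apply,
    inner_neg_right]

theorem rotSlot_comm_same (i j : Fin k) (a : R3) (x : TenComp k) :
    rotSlot i a (rotSlot j a x) = rotSlot j a (rotSlot i a x) := by
  by_cases h : i = j
  · rw [h]
  · exact rotSlot_comm h a a x

/-- The infinitesimal rotation about `a`. -/
def rotAll : R3 →L[ℝ] TenComp k →L[ℝ] TenComp k := ∑ j, rotSlot j

theorem rotAll_apply (a : R3) (x : TenComp k) : rotAll a x = ∑ j, rotSlot j a x := by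
  simp [rotAll]

/-- Rotations of different factors commute, so only the `j`-th summand contributes a commutator. -/
theorem rotAll_rotSlot (j : Fin k) (a b : R3) (x : TenComp k) :
    rotAll a (rotSlot j b x) = rotSlot j b (rotAll a x) + rotSlot j (crossL a b) x := by
  rw [rotAll_apply, rotAll_apply, map_sum, ← Finset.add_sum_erase _ _ (Finset.mem_univ j),
    ← Finset.add_sum_erase _ (fun i => rotSlot j b (rotSlot i a x)) (Finset.mem_univ j),
    rotSlot_lie, Finset.sum_congr rfl fun i hi =>
      rotSlot_comm (Finset.ne_of_mem_erase hi) a b x]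
  abel

theorem rotAll_rotAll (a b : R3) (x : TenComp k) :
    rotAll a (rotAll b x) = rotAll b (rotAll a x) + rotAll (crossL a b) x := by
  rw [rotAll_apply b, map_sum, Finset.sum_congr rfl fun j _ => rotAll_rotSlot j a b x,
    Finset.sum_add_distrib, rotAll_apply b, rotAll_apply (crossL a b)]

theorem inner_rotAll (a : R3) (x y : TenComp k) : ⟪rotAll a x, y⟫ = -⟪x, rotAll a y⟫ := by
  simp only [rotAll_apply, sum_inner, inner_sum, inner_rotSlot, Finset.sum_neg_distrib]

end TenComp

/-! ### The fibres of the bundle of symmetric traceless tensors -/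

namespace TenComp

variable {k : ℕ}

theorem coord_tprod (y : Fin k → R3) (I : Fin k → Fin 3) :
    Ten.coord k (PiTensorProduct.tprod ℝ y) I = ∏ j, y j (I j) := by
  simp [Ten.coord, Basis.piTensorProduct_repr_tprod_apply]

theorem prod_update {M : Type*} [CommMonoid M] (g : Fin k → Fin 3 → M) (I : Fin k → Fin 3)
    (j : Fin k) (b : Fin 3) :
    ∏ i, g i (Function.update I j b i) = g j b * ∏ i ∈ Finset.univ.erase j, g i (I i) := by
  rw [← Finset.mul_prod_erase _ _ (Finset.mem_univ j), Function.update_self]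
  exact congrArg _ (Finset.prod_congr rfl fun i hi => by
    rw [Function.update_of_ne (Finset.ne_of_mem_erase hi)])

theorem prod_update_left {M : Type*} [CommMonoid M] (y : Fin k → R3) (g : R3 → Fin 3 → M)
    (I : Fin k → Fin 3) (j : Fin k) (b : R3) :
    ∏ i, g (Function.update y j b i) (I i) =
      g b (I j) * ∏ i ∈ Finset.univ.erase j, g (y i) (I i) := by
  rw [← Finset.mul_prod_erase _ _ (Finset.mem_univ j), Function.update_self]
  exact congrArg _ (Finset.prod_congr rfl fun i hi => by
    rw [Function.update_of_ne (Finset.ne_of_mem_erase hi)])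

theorem rotSlot_tprod (j : Fin k) (a : R3) (y : Fin k → R3) :
    rotSlot j a (Ten.coord k (PiTensorProduct.tprod ℝ y)) =
      Ten.coord k (PiTensorProduct.tprod ℝ (Function.update y j (crossL a (y j)))) := by
  ext I
  rw [rotSlot_apply, coord_tprod, prod_update_left y (fun v i => v i), ← sum_crossMat_mul,
    Finset.sum_mul]
  refine Finset.sum_congr rfl fun b _ => ?_
  rw [coord_tprod, prod_update (fun i c => y i c), mul_assoc]

theorem rotSlot_coord (j : Fin k) (a : R3) (T : Ten k) :
    rotSlot j a (Ten.coord k T) = Ten.coord k (PiTensorProduct.map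
      (fun i : Fin k => if i = j then (crossL a : R3 →ₗ[ℝ] R3) else LinearMap.id) T) := by
  have h : (rotSlot j a : TenComp k →ₗ[ℝ] TenComp k) ∘ₗ (Ten.coord k).toLinearMap =
      (Ten.coord k).toLinearMap ∘ₗ PiTensorProduct.map
        (fun i : Fin k => if i = j then (crossL a : R3 →ₗ[ℝ] R3) else LinearMap.id) := by
    refine PiTensorProduct.ext (MultilinearMap.ext fun y => ?_)
    change rotSlot j a (Ten.coord k (PiTensorProduct.tprod ℝ y)) = _
    rw [rotSlot_tprod, LinearMap.compMultilinearMap_apply, LinearMap.comp_apply,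
      PiTensorProduct.map_tprod]
    refine congrArg (fun z => Ten.coord k (PiTensorProduct.tprod ℝ z)) (funext fun i => ?_)
    by_cases hi : i = j
    · subst hi; simp
    · simp [hi]
  exact LinearMap.congr_fun h T

theorem inner_tprod_rotSlot (j : Fin k) (a : R3) (y : Fin k → R3) (x : TenComp k) :
    ⟪Ten.coord k (PiTensorProduct.tprod ℝ y), rotSlot j a x⟫ =
      -⟪Ten.coord k (PiTensorProduct.tprod ℝ (Function.update y j (crossL a (y j)))), x⟫ := by
  rw [← rotSlot_tprod, inner_rotSlot, neg_neg]

theorem eq_zero_of_inner_tprod {x : TenComp k}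
    (h : ∀ y : Fin k → R3, ⟪Ten.coord k (PiTensorProduct.tprod ℝ y), x⟫ = 0) : x = 0 := by
  have h2 : ∀ T : Ten k, ⟪Ten.coord k T, x⟫ = 0 := by
    intro T
    induction T using PiTensorProduct.induction_on with
    | smul_tprod r y => rw [map_smul, inner_smul_left, h, mul_zero]
    | add T S hT hS => rw [map_add, inner_add_left, hT, hS, add_zero]
  have := h2 ((Ten.coord k).symm x)
  rwa [LinearEquiv.apply_symm_apply, inner_self_eq_zero] at this

/-- The tensors on which the rotations of any two factors compose to `-1`. -/
def fibre (k : ℕ) (p : S2) : Submodule ℝ (TenComp k) where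
  carrier := {x | ∀ i j : Fin k, rotSlot i p (rotSlot j p x) = -x}
  add_mem' {x y} hx hy i j := by rw [map_add, map_add, hx, hy, neg_add]
  zero_mem' i j := by simp
  smul_mem' c x hx i j := by rw [map_smul, map_smul, hx, smul_neg]

theorem rotSlot_mem {p : S2} {x : TenComp k} (hx : x ∈ fibre k p) (l : Fin k) :
    rotSlot l p x ∈ fibre k p := fun i j => by
  rw [rotSlot_comm_same j l, rotSlot_comm_same i l, hx, map_neg]

theorem rotSlot_eq_rotSlot {p : S2} {x : TenComp k} (hx : x ∈ fibre k p) (i j : Fin k) :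
    rotSlot i p x = rotSlot j p x := by
  have h := rotSlot_mem hx j i i
  rw [hx i j, map_neg] at h
  exact neg_injective h

/-- All `k` factor rotations agree on the fibre. This is the source of the factor `k` in the Euler
number. -/
theorem rotAll_of_mem {p : S2} {x : TenComp k} (hx : x ∈ fibre k p) (j : Fin k) :
    rotAll (p : R3) x = (k : ℝ) • rotSlot j p x := by
  rw [rotAll_apply, Finset.sum_congr rfl fun i _ => rotSlot_eq_rotSlot hx i j]
  simp [Nat.cast_smul_eq_nsmul]

variable {p : S2} {v : R3}

/-- The covector `v - i (p × v)`. -/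
def nullVec (p : S2) (v : R3) (a : Fin 3) : ℂ := v a - Complex.I * crossL p v a

/-- Since `p × (p × v) = -v`, the vector `n = v - i (p × v)` is an eigenvector of `p × ·` with
eigenvalue `i`. -/
theorem sum_crossMat_nullVec (hv : v ∈ S2.tangent p) (a : Fin 3) :
    ∑ b, (crossMat p a b : ℂ) * nullVec p v b = Complex.I * nullVec p v a := by
  have h1 : ∑ b, (crossMat p a b : ℂ) * (v b : ℂ) = crossL p v a := by
    rw [← sum_crossMat_mul]; push_cast; rfl
  have h2 : ∑ b, (crossMat p a b : ℂ) * (crossL p v b : ℂ) = -v a := by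
    have := sum_crossMat_mul p (crossL p v) a
    rw [S2.crossL_coe_crossL hv] at this
    rw [PiLp.neg_apply] at this
    rw [← Complex.ofReal_neg, ← this]; push_cast; rfl
  have h3 : ∀ b, (crossMat p a b : ℂ) * nullVec p v b =
      (crossMat p a b : ℂ) * (v b : ℂ) - Complex.I * ((crossMat p a b : ℂ) * (crossL p v b : ℂ)) :=
    fun b => by rw [nullVec]; ring
  rw [Finset.sum_congr rfl fun b _ => h3 b, Finset.sum_sub_distrib, ← Finset.mul_sum, h1, h2, nullVec]
  linear_combination (crossL p v a : ℂ) * Complex.I_mul_I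

/-- The real part of `z` times the `k`-th tensor power of `v - i (p × v)`. -/
def rePow (k : ℕ) (p : S2) (v : R3) : ℂ →ₗ[ℝ] TenComp k where
  toFun z := WithLp.toLp 2 fun I => (z * ∏ j, nullVec p v (I j)).re
  map_add' z w := by ext I; simp [add_mul]
  map_smul' c z := by ext I; simp [mul_assoc]

theorem rePow_apply (z : ℂ) (I : Fin k → Fin 3) :
    rePow k p v z I = (z * ∏ j, nullVec p v (I j)).re := rfl

theorem rotSlot_rePow (hv : v ∈ S2.tangent p) (j : Fin k) (z : ℂ) :
    rotSlot j p (rePow k p v z) = rePow k p v (Complex.I * z) := by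
  ext I
  simp only [rotSlot_apply, rePow_apply, prod_update (fun _ c => nullVec p v c)]
  rw [← Finset.mul_prod_erase _ _ (Finset.mem_univ j)]
  have : Complex.I * z * (nullVec p v (I j) * ∏ i ∈ Finset.univ.erase j, nullVec p v (I i)) =
      ∑ b, (crossMat p (I j) b : ℂ) *
        (z * (nullVec p v b * ∏ i ∈ Finset.univ.erase j, nullVec p v (I i))) := by
    have h := sum_crossMat_nullVec hv (I j)
    calc _ = (Complex.I * nullVec p v (I j)) *
          (z * ∏ i ∈ Finset.univ.erase j, nullVec p v (I i)) := by ring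
      _ = _ := by rw [← h, Finset.sum_mul]; exact Finset.sum_congr rfl fun b _ => by ring
  rw [this, Complex.re_sum]
  exact Finset.sum_congr rfl fun b _ => (Complex.re_ofReal_mul _ _).symm

theorem rePow_mem (hv : v ∈ S2.tangent p) (z : ℂ) : rePow k p v z ∈ fibre k p := fun i j => by
  rw [rotSlot_rePow hv, rotSlot_rePow hv, ← mul_assoc, Complex.I_mul_I, neg_one_mul, map_neg]

/-- The bilinear pairing of `v` with `v - i (p × v)` is `1`, hence so is the pairing of the `k`-th
powers. Evaluating on `v ⊗ ⋯ ⊗ v` therefore recovers `Re z`. -/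
theorem inner_tprod_rePow (hn : ⟪v, v⟫ = 1) (z : ℂ) :
    ⟪Ten.coord k (PiTensorProduct.tprod ℝ fun _ => v), rePow k p v z⟫ = z.re := by
  have h1 : ∑ a, (v a : ℂ) * nullVec p v a = 1 := by
    have h2 : ∑ a, (v a : ℂ) * (v a : ℂ) = 1 := by
      rw [R3.inner_eq] at hn
      rw [Fin.sum_univ_three]; exact_mod_cast hn
    have h3 : ∑ a, (v a : ℂ) * (crossL p v a : ℂ) = 0 := by
      have := inner_crossL_right (p : R3) v
      rw [R3.inner_eq] at this
      rw [Fin.sum_univ_three]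
      simp only [mul_comm (v.ofLp _ : ℂ)]
      exact_mod_cast this
    have h4 : ∀ a, (v a : ℂ) * nullVec p v a =
        (v a : ℂ) * (v a : ℂ) - Complex.I * ((v a : ℂ) * (crossL p v a : ℂ)) :=
      fun a => by rw [nullVec]; ring
    rw [Finset.sum_congr rfl fun a _ => h4 a, Finset.sum_sub_distrib, ← Finset.mul_sum, h2, h3]
    simp
  have h5 : z = ∑ I : Fin k → Fin 3, ((∏ j, v (I j) : ℝ) : ℂ) * (z * ∏ j, nullVec p v (I j)) := by
    have := Fintype.sum_pow (fun a => (v a : ℂ) * nullVec p v a) k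
    rw [h1, one_pow] at this
    calc z = z * 1 := (mul_one z).symm
      _ = _ := by
        rw [this, Finset.mul_sum]
        refine Finset.sum_congr rfl fun I _ => ?_
        rw [Finset.prod_mul_distrib]; push_cast; ring
  conv_rhs => rw [h5]
  rw [Complex.re_sum, PiLp.inner_apply]
  refine Finset.sum_congr rfl fun I _ => ?_
  rw [Complex.re_ofReal_mul, coord_tprod, rePow_apply]
  simp [mul_comm]

/-- An element of the fibre is determined by two of its components. -/
theorem eq_zero_of_mem_fibre (hv : v ∈ S2.tangent p) (hn : ⟪v, v⟫ = 1) (l : Fin k) {x : TenComp k}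
    (hx : x ∈ fibre k p) (h0 : ⟪Ten.coord k (PiTensorProduct.tprod ℝ fun _ => v), x⟫ = 0)
    (h1 : ⟪Ten.coord k (PiTensorProduct.tprod ℝ fun _ => v), rotSlot l p x⟫ = 0) : x = 0 := by
  -- Induction on the set of factors allowed to differ from `v`. The tensor `x` stays quantified
  -- because the step also uses the hypothesis for its rotation.
  have key : ∀ s : Finset (Fin k), ∀ x ∈ fibre k p,
      ⟪Ten.coord k (PiTensorProduct.tprod ℝ fun _ => v), x⟫ = 0 →
      ⟪Ten.coord k (PiTensorProduct.tprod ℝ fun _ => v), rotSlot l p x⟫ = 0 →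
      ∀ y : Fin k → R3, (∀ i ∉ s, y i = v) →
        ⟪Ten.coord k (PiTensorProduct.tprod ℝ y), x⟫ = 0 := by
    intro s
    induction s using Finset.induction_on with
    | empty =>
      intro x _ h0 _ y hy
      rw [show y = fun _ => v from funext fun i => hy i (Finset.notMem_empty i)]
      exact h0
    | insert j s hj ih =>
      intro x hx h0 h1 y hy
      have hy' : ∀ i ∉ s, Function.update y j v i = v := fun i hi => by
        by_cases hij : i = j
        · rw [hij, Function.update_self]
        · rw [Function.update_of_ne hij]; exact hy i (by simp [hij, hi])
      have e1 := ih x hx h0 h1 _ hy'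
      -- A factor `p × v` is traded for a factor `v` paired with `R_j x`, and `R_j x = R_l x`.
      have e2 : ⟪Ten.coord k (PiTensorProduct.tprod ℝ (Function.update y j (crossL p v))), x⟫ = 0 := by
        have h2 := ih (rotSlot l p x) (rotSlot_mem hx l) h1
          (by rw [hx, inner_neg_right, h0, neg_zero]) _ hy'
        rw [rotSlot_eq_rotSlot hx l j, inner_tprod_rotSlot, Function.update_self,
          Function.update_idem, neg_eq_zero] at h2
        exact h2
      -- A factor `p` pairs to zero because `x = -R_j R_j x` and `p × p = 0`.
      have e3 : ⟪Ten.coord k (PiTensorProduct.tprod ℝ (Function.update y j (p : R3))), x⟫ = 0 := by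
        rw [← neg_eq_zero, ← inner_neg_right, ← hx j j, inner_tprod_rotSlot, Function.update_self,
          crossL_self, Function.update_idem, MultilinearMap.map_update_zero, map_zero,
          inner_zero_left, neg_zero]
      rw [← Function.update_eq_self j y, S2.eq_sum_of_unit_tangent hv hn (y j),
        MultilinearMap.map_update_add, MultilinearMap.map_update_add,
        MultilinearMap.map_update_smul, MultilinearMap.map_update_smul,
        MultilinearMap.map_update_smul]
      simp only [map_add, map_smul, inner_add_left, inner_smul_left, e1, e2, e3, mul_zero, add_zero]
  exact eq_zero_of_inner_tprod fun y => key Finset.univ x hx h0 h1 y (by simp)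

theorem exists_rePow (hv : v ∈ S2.tangent p) (hn : ⟪v, v⟫ = 1) (l : Fin k) {x : TenComp k}
    (hx : x ∈ fibre k p) : ∃ z, rePow k p v z = x := by
  -- The imaginary part is read off from the rotated tensor, since `Re (i z) = -Im z`.
  refine ⟨⟨⟪Ten.coord k (PiTensorProduct.tprod ℝ fun _ => v), x⟫,
    -⟪Ten.coord k (PiTensorProduct.tprod ℝ fun _ => v), rotSlot l p x⟫⟩, ?_⟩
  rw [eq_comm, ← sub_eq_zero]
  refine eq_zero_of_mem_fibre hv hn l (Submodule.sub_mem _ hx (rePow_mem hv _)) ?_ ?_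
  · rw [inner_sub_right, inner_tprod_rePow hn, sub_self]
  · rw [map_sub, inner_sub_right, rotSlot_rePow hv, inner_tprod_rePow hn]
    simp

theorem rePow_injective (hv : v ∈ S2.tangent p) (hn : ⟪v, v⟫ = 1) (l : Fin k) :
    Function.Injective (rePow k p v) := by
  rw [← LinearMap.ker_eq_bot, LinearMap.ker_eq_bot']
  intro z hz
  apply Complex.ext
  · rw [← inner_tprod_rePow (k := k) (p := p) hn z, hz, inner_zero_right, Complex.zero_re]
  · have h := inner_tprod_rePow (k := k) (p := p) hn (Complex.I * z)
    rw [← rotSlot_rePow hv l, hz, map_zero, inner_zero_right] at h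
    simpa using h.symm

theorem finrank_fibre (p : S2) (l : Fin k) : Module.finrank ℝ (fibre k p) = 2 := by
  obtain ⟨v, hv, hn⟩ := S2.exists_unit_tangent p
  have h : fibre k p = LinearMap.range (rePow k p v) := by
    ext x
    constructor
    · exact fun hx => exists_rePow hv hn l hx
    · rintro ⟨z, rfl⟩
      exact rePow_mem hv z
  rw [h, LinearMap.finrank_range_of_inj (rePow_injective hv hn l), Complex.finrank_real_complex]

end TenComp

/-! ### Symmetric traceless tangent tensors as the tensors with `R_i R_j = -1` -/

namespace TenComp

variable {k m : ℕ} {p : S2}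

theorem coord_reindex (σ : Equiv.Perm (Fin k)) (T : Ten k) (I : Fin k → Fin 3) :
    Ten.coord k (PiTensorProduct.reindex ℝ (fun _ : Fin k => R3) σ T) I =
      Ten.coord k T (fun i => I (σ i)) := by
  induction T using PiTensorProduct.induction_on with
  | smul_tprod r y =>
    rw [map_smul, map_smul, map_smul, PiLp.smul_apply, PiLp.smul_apply,
      PiTensorProduct.reindex_tprod, coord_tprod, coord_tprod,
      ← Equiv.prod_comp σ]
    exact congrArg (r • ·) (Finset.prod_congr rfl fun i _ =>
      congrArg (fun l => y l (I (σ i))) (σ.symm_apply_apply i))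
  | add T S hT hS => rw [map_add, map_add, map_add, PiLp.add_apply, PiLp.add_apply, hT, hS]

theorem coord_mem_symmetric {T : Ten k} :
    T ∈ Ten.symmetric k ↔
      ∀ (σ : Equiv.Perm (Fin k)) (I), Ten.coord k T (fun i => I (σ i)) = Ten.coord k T I := by
  simp only [Ten.symmetric, Submodule.mem_iInf, LinearMap.mem_eqLocus, LinearEquiv.coe_coe,
    LinearMap.id_coe, id_eq, ← coord_reindex]
  refine forall_congr' fun σ => ?_
  rw [← (Ten.coord k).injective.eq_iff]
  exact ⟨fun h I => by rw [h], fun h => by ext I; exact h I⟩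

theorem coord_tr (T : Ten (m + 2)) (I : Fin m → Fin 3) :
    Ten.coord m (Ten.tr m T) I =
      ∑ a, Ten.coord (m + 2) T (Fin.cons a (Fin.cons a I : Fin (m + 1) → Fin 3)) := by
  induction T using PiTensorProduct.induction_on with
  | smul_tprod r y =>
    simp only [map_smul, PiLp.smul_apply, coord_tprod, ← Finset.smul_sum]
    congr 1
    rw [Ten.tr, PiTensorProduct.lift.tprod]
    simp only [MultilinearMap.coe_mk, map_smul, PiLp.smul_apply, coord_tprod, Fin.prod_univ_succ,
      Fin.cons_zero, Fin.cons_succ, ← mul_assoc, ← Finset.sum_mul, smul_eq_mul, R3.inner_eq]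
    rw [Fin.sum_univ_three]
    rfl
  | add T S hT hS => simp only [map_add, PiLp.add_apply, hT, hS, Finset.sum_add_distrib]

theorem rotSlot_rotSlot_of_tangent {T : Ten k} (hT : T ∈ Ten.tangent k p) (j : Fin k) :
    rotSlot j p (rotSlot j p (Ten.coord k T)) = -Ten.coord k T := by
  obtain ⟨S, rfl⟩ := hT
  induction S using PiTensorProduct.induction_on with
  | smul_tprod r y =>
    simp only [map_smul, PiTensorProduct.map_tprod, rotSlot_tprod, Function.update_self,
      Function.update_idem]
    rw [show crossL p (crossL p ((S2.tangent p).subtype (y j))) =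
        (-1 : ℝ) • (S2.tangent p).subtype (y j) by
      rw [neg_one_smul]; exact S2.crossL_coe_crossL (y j).2, MultilinearMap.map_update_smul,
      Function.update_eq_self j (fun i => (S2.tangent p).subtype (y i)), map_smul, neg_one_smul,
      smul_neg]
  | add T S hT hS => simp only [map_add, hT, hS, neg_add]

theorem mem_tangent_of_rotSlot {T : Ten k}
    (h : ∀ j, rotSlot j p (rotSlot j p (Ten.coord k T)) = -Ten.coord k T) :
    T ∈ Ten.tangent k p := by
  let L : R3 →ₗ[ℝ] R3 := crossL p
  -- Applying `(p × ·)²` to the factors in `s` changes `T` only by a sign. With all factors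
  -- included, the image lies in the tangent tensor power because `p × ·` takes values in the
  -- tangent plane.
  have key : ∀ s : Finset (Fin k), ∃ c : ℝ,
      T = c • PiTensorProduct.map (fun i => if i ∈ s then L ∘ₗ L else LinearMap.id) T := by
    intro s
    induction s using Finset.induction_on with
    | empty => exact ⟨1, by simp [PiTensorProduct.map_id]⟩
    | insert j s hj ih =>
      obtain ⟨c, hc⟩ := ih
      refine ⟨-c, ?_⟩
      have h1 := h j
      rw [rotSlot_coord, rotSlot_coord, ← map_neg, (Ten.coord k).injective.eq_iff] at h1
      have h2 : (fun i => if i ∈ insert j s then L ∘ₗ L else LinearMap.id) = fun i =>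
          (if i ∈ s then L ∘ₗ L else LinearMap.id) ∘ₗ
            ((if i = j then L else LinearMap.id) ∘ₗ if i = j then L else LinearMap.id) := by
        funext i
        by_cases hi : i = j
        · subst hi; simp [hj]
        · simp [hi]
      rw [h2, PiTensorProduct.map_comp, PiTensorProduct.map_comp, LinearMap.comp_apply,
        LinearMap.comp_apply, h1, map_neg, neg_smul, smul_neg, neg_neg]
      exact hc
  obtain ⟨c, hc⟩ := key Finset.univ
  rw [hc]
  refine Submodule.smul_mem _ _ ?_
  let q : R3 →ₗ[ℝ] S2.tangent p := LinearMap.codRestrict _ (L ∘ₗ L) fun x =>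
    S2.mem_tangent_iff.2 (inner_crossL_left _ _)
  refine ⟨PiTensorProduct.map (fun _ => q) T, ?_⟩
  rw [← LinearMap.comp_apply, ← PiTensorProduct.map_comp]
  simp [q]

/-- The hypothesis puts `x` in the image of `p × ·` on the `j`-th factor, and that image is
orthogonal to `p`. -/
theorem sum_coe_mul_of_rotSlot {x : TenComp k} {j : Fin k}
    (h : rotSlot j p (rotSlot j p x) = -x) (I : Fin k → Fin 3) :
    ∑ b, (p : R3) b * x (Function.update I j b) = 0 := by
  have h1 : ∀ b, x (Function.update I j b) =
      -∑ c, crossMat p b c * rotSlot j p x (Function.update I j c) := fun b => by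
    have := congrArg (fun y : TenComp k => y (Function.update I j b)) h
    simp only [PiLp.neg_apply] at this
    rw [rotSlot_apply] at this
    simp only [Function.update_self, Function.update_idem] at this
    rw [this, neg_neg]
  simp only [h1, Fin.sum_univ_three]
  simp [crossMat]
  ring

/-- The difference of the two sides is the antisymmetric part of the rotated tensor. In a plane this
has a single coefficient, which is the trace up to sign. -/
theorem sum_crossMat_mul_symm (p : R3) (t : Fin 3 → Fin 3 → ℝ) (hs : ∀ a b, t a b = t b a)
    (ht : ∑ a, t a a = 0) (hp : ∀ a, ∑ b, p b * t a b = 0) (a b : Fin 3) :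
    ∑ c, crossMat p a c * t c b = ∑ c, crossMat p b c * t a c := by
  have h0 := hp 0
  have h1 := hp 1
  have h2 := hp 2
  rw [Fin.sum_univ_three] at h0 h1 h2 ht
  rw [hs 1 0] at h1
  rw [hs 2 0, hs 2 1] at h2
  rw [Fin.sum_univ_three, Fin.sum_univ_three]
  fin_cases a <;> fin_cases b <;> simp [crossMat, hs 1 0, hs 2 0, hs 2 1]
  all_goals first
    | linear_combination -p 2 * ht + h2
    | linear_combination p 1 * ht - h1
    | linear_combination p 2 * ht - h2
    | linear_combination -p 0 * ht + h0
    | linear_combination -p 1 * ht + h1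
    | linear_combination p 0 * ht - h0

theorem exists_perm_zero_one {i j : Fin (m + 2)} (h : i ≠ j) :
    ∃ σ : Equiv.Perm (Fin (m + 2)), σ 0 = i ∧ σ 1 = j := by
  refine ⟨Equiv.swap 0 i * Equiv.swap 1 (Equiv.swap 0 i j), ?_, ?_⟩
  · have h1 : (0 : Fin (m + 2)) ≠ Equiv.swap 0 i j := fun h2 => by
      have := congrArg (Equiv.swap 0 i) h2
      rw [Equiv.swap_apply_left, Equiv.swap_apply_self] at this
      exact h this
    rw [Equiv.Perm.mul_apply, Equiv.swap_apply_of_ne_of_ne (by simp) h1, Equiv.swap_apply_left]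
  · rw [Equiv.Perm.mul_apply, Equiv.swap_apply_left, Equiv.swap_apply_self]

theorem symTrBundle_eq_fibre (m : ℕ) (p : S2) : symTrBundle (m + 2) p = fibre (m + 2) p := by
  ext x
  obtain ⟨T, rfl⟩ := (Ten.coord (m + 2)).surjective x
  rw [symTrBundle]
  erw [Submodule.mem_map_equiv]
  rw [LinearEquiv.symm_apply_apply]
  simp only [Submodule.mem_inf, coord_mem_symmetric]
  have htr : T ∈ Ten.traceless (m + 2) ↔ ∀ I : Fin m → Fin 3,
      ∑ a, Ten.coord (m + 2) T (Fin.cons a (Fin.cons a I : Fin (m + 1) → Fin 3)) = 0 := by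
    simp only [← coord_tr]
    rw [Ten.traceless, LinearMap.mem_ker, ← (Ten.coord m).map_eq_zero_iff]
    exact ⟨fun h I => by rw [h]; rfl, fun h => by ext I; exact h I⟩
  rw [htr]
  constructor
  · rintro ⟨⟨hT, hs⟩, ht⟩ i j
    have hsq := rotSlot_rotSlot_of_tangent hT
    by_cases hij : i = j
    · rw [hij]; exact hsq j
    -- Writing `-x` as `R_i R_i x` reduces the claim to `R_j x = R_i x`.
    rw [← hsq i]
    refine congrArg (rotSlot i (p : R3)) ?_
    ext I
    generalize hx : Ten.coord (m + 2) T = x at *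
    -- With all indices other than `i` and `j` frozen, `x` is a symmetric traceless tangent
    -- 2-tensor.
    have hc := sum_crossMat_mul_symm p
      (fun a b => x (Function.update (Function.update I i a) j b)) ?_ ?_ ?_ (I i) (I j)
    · rw [rotSlot_apply, rotSlot_apply]
      refine Eq.trans ?_ (hc.symm.trans ?_)
      · refine Finset.sum_congr rfl fun c _ => ?_
        rw [Function.update_eq_self]
      · refine Finset.sum_congr rfl fun c _ => ?_
        rw [Function.update_comm hij, Function.update_eq_self]
    · intro a b
      rw [← hs (Equiv.swap i j)]
      refine congrArg x.ofLp (funext fun l => ?_)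
      by_cases hl : l = i
      · subst hl; simp [hij]
      · by_cases hl' : l = j
        · subst hl'; simp [hij]
        · rw [Equiv.swap_apply_of_ne_of_ne hl hl']; simp [hl, hl']
    · obtain ⟨σ, h0, h1⟩ := exists_perm_zero_one hij
      rw [← ht fun l => I (σ l.succ.succ)]
      refine Finset.sum_congr rfl fun a _ => ?_
      rw [← hs σ]
      refine congrArg x.ofLp (funext fun l => ?_)
      refine Fin.cases ?_ (fun l => Fin.cases ?_ (fun l => ?_) l) l
      · simp [h0, hij]
      · simp [h1]
      · have hi : σ l.succ.succ ≠ i := fun h => by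
          rw [← h0, σ.injective.eq_iff] at h; simp [Fin.ext_iff] at h
        have hj : σ l.succ.succ ≠ j := fun h => by
          rw [← h1, σ.injective.eq_iff] at h; simp [Fin.ext_iff] at h
        simp [hi, hj]
    · exact fun a => sum_coe_mul_of_rotSlot (hsq j) _
  · intro hx
    obtain ⟨v, hv, hn⟩ := S2.exists_unit_tangent p
    refine ⟨⟨mem_tangent_of_rotSlot fun j => hx j j, ?_⟩, ?_⟩
    · intro σ I
      obtain ⟨z, hz⟩ := exists_rePow hv hn 0 hx
      rw [← hz, rePow_apply, rePow_apply, Equiv.prod_comp σ fun i => nullVec p v (I i)]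
    · intro I
      obtain ⟨z, hz⟩ := exists_rePow hv hn 0 hx
      -- `v` and `p × v` are orthogonal of equal length, so `n` is null and the trace of `n^{⊗k}`
      -- vanishes.
      have hnull : ∑ a, nullVec p v a * nullVec p v a = 0 := by
        have e1 := S2.inner_crossL_crossL_self hv
        have e2 := inner_crossL_right (p : R3) v
        rw [R3.inner_eq, R3.inner_eq] at e1
        rw [R3.inner_eq] at e2
        have e1' : (crossL p v 0 * crossL p v 0 + crossL p v 1 * crossL p v 1 +
          crossL p v 2 * crossL p v 2 : ℂ) = v 0 * v 0 + v 1 * v 1 + v 2 * v 2 := by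
          exact_mod_cast e1
        have e2' : (crossL p v 0 * v 0 + crossL p v 1 * v 1 + crossL p v 2 * v 2 : ℂ) = 0 := by
          exact_mod_cast e2
        simp only [nullVec, Fin.sum_univ_three]
        linear_combination -e1' - 2 * Complex.I * e2' +
          (crossL p v 0 * crossL p v 0 + crossL p v 1 * crossL p v 1 +
            crossL p v 2 * crossL p v 2 : ℂ) * Complex.I_mul_I
      simp only [← hz, rePow_apply, Fin.prod_univ_succ, Fin.cons_zero, Fin.cons_succ]
      rw [← Complex.re_sum]
      have : ∑ a, z * (nullVec p v a * (nullVec p v a * ∏ i, nullVec p v (I i))) =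
          (∑ a, nullVec p v a * nullVec p v a) * (z * ∏ i, nullVec p v (I i)) := by
        rw [Finset.sum_mul]
        exact Finset.sum_congr rfl fun a _ => by ring
      rw [this, hnull, zero_mul, Complex.zero_re]

theorem symTrJ_apply (m : ℕ) (p : S2) (x : TenComp (m + 2)) :
    symTrJ (m + 2) p x = rotSlot 0 p x := by
  obtain ⟨T, rfl⟩ := (Ten.coord (m + 2)).surjective x
  rw [rotSlot_coord]
  simp only [symTrJ, LinearMap.comp_apply, LinearEquiv.coe_coe, LinearEquiv.symm_apply_apply]
  refine congrArg (fun f => Ten.coord (m + 2) (PiTensorProduct.map f T)) (funext fun i => ?_)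
  by_cases hi : i = 0
  · subst hi; simp; rfl
  · simp [hi, Fin.val_eq_zero_iff]

end TenComp

/-! ### The hermitian line bundle and its rotation invariant connection -/

namespace TenComp

open S2

variable {k : ℕ} {p : S2}

/-- This holds on all tensors, so `-R_j²` is a globally defined smooth projection onto the tensors
tangent in the `j`-th factor. -/
theorem rotSlot_cube (p : S2) (j : Fin k) (x : TenComp k) :
    rotSlot j p (rotSlot j p (rotSlot j p x)) = -rotSlot j p x := by
  have h : crossMat p * (crossMat p * crossMat p) = crossMat (-p) := by
    have h := coe_sq p
    ext a b
    fin_cases a <;> fin_cases b <;> simp [crossMat]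
    all_goals first
      | ring1
      | linear_combination (-(p : R3) 0) * h
      | linear_combination (-(p : R3) 1) * h
      | linear_combination (-(p : R3) 2) * h
      | linear_combination (p : R3) 0 * h
      | linear_combination (p : R3) 1 * h
      | linear_combination (p : R3) 2 * h
  simp only [rotSlot_eq, slot_slot]
  rw [h, ← rotSlot_eq, map_neg, neg_apply]
  rfl

theorem smooth_rotSlot (j : Fin k) {s : S2 → TenComp k} (hs : Smooth s) :
    Smooth (fun q => rotSlot j (q : R3) (s q)) := smooth_coe.bilin (rotSlot j) hs

/-- Apply the commuting projections `-R_j²` to the constant map `v`; at `p` they fix `v`. -/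
theorem exists_section_rotSlot_sq {v : TenComp k} (hv : v ∈ fibre k p) (t : Finset (Fin k)) :
    ∃ s : S2 → TenComp k, Smooth s ∧ s p = v ∧
      ∀ j ∈ t, ∀ q : S2, rotSlot j (q : R3) (rotSlot j (q : R3) (s q)) = -s q := by
  induction t using Finset.induction_on with
  | empty => exact ⟨fun _ => v, smooth_const v, rfl, by simp⟩
  | insert j t hj ih =>
    obtain ⟨s, hs, hp, hsq⟩ := ih
    refine ⟨fun q => -rotSlot j (q : R3) (rotSlot j (q : R3) (s q)),
      (smooth_rotSlot j (smooth_rotSlot j hs)).neg, ?_, ?_⟩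
    · simp only [hp]
      rw [hv, neg_neg]
    · intro i hi q
      rcases Finset.mem_insert.1 hi with rfl | hi
      · simp only [map_neg, rotSlot_cube, neg_neg]
      · simp only [map_neg]
        rw [rotSlot_comm_same i j, rotSlot_comm_same i j, rotSlot_comm_same i j,
          rotSlot_comm_same i j, hsq i hi q, map_neg, map_neg]

/-- Once `R_l² = R_j² = -1`, the product `R_l R_j` is an involution, and `(1 - R_l R_j) / 2`
projects onto its `-1` eigenspace. These projections commute and fix `v` at `p`. -/
theorem exists_section_rotSlot_rotSlot (l : Fin k) {v : TenComp k} (hv : v ∈ fibre k p)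
    (t : Finset (Fin k)) : ∃ s : S2 → TenComp k, Smooth s ∧ s p = v ∧
      (∀ j, ∀ q : S2, rotSlot j (q : R3) (rotSlot j (q : R3) (s q)) = -s q) ∧
      ∀ j ∈ t, ∀ q : S2, rotSlot l (q : R3) (rotSlot j (q : R3) (s q)) = -s q := by
  induction t using Finset.induction_on with
  | empty =>
    obtain ⟨s, hs, hp, hsq⟩ := exists_section_rotSlot_sq hv Finset.univ
    exact ⟨s, hs, hp, fun j => hsq j (Finset.mem_univ j), by simp⟩
  | insert j t hj ih =>
    obtain ⟨s, hs, hp, hsq, hl⟩ := ih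
    refine ⟨fun q => (2⁻¹ : ℝ) • (s q - rotSlot l (q : R3) (rotSlot j (q : R3) (s q))),
      (smooth_const (2⁻¹ : ℝ)).smul (hs.sub (smooth_rotSlot l (smooth_rotSlot j hs))), ?_, ?_, ?_⟩
    · simp only [hp]
      rw [hv, sub_neg_eq_add, ← two_smul ℝ v, smul_smul]
      norm_num
    · intro i q
      simp only [map_smul, map_sub]
      rw [rotSlot_comm_same i l, rotSlot_comm_same i j, rotSlot_comm_same i l,
        rotSlot_comm_same i j, hsq i q, map_neg, map_neg, ← neg_sub', smul_neg]
    · intro i hi q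
      simp only [map_smul, map_sub]
      rcases Finset.mem_insert.1 hi with rfl | hi
      · rw [rotSlot_comm_same i l (q : R3) (rotSlot i (q : R3) (s q)), hsq i q, map_neg, map_neg, hsq l q, neg_neg,
          ← smul_neg, neg_sub]
      · rw [rotSlot_comm_same i l, rotSlot_comm_same i j,
          rotSlot_comm_same l j (q : R3) (rotSlot i (q : R3) (s q)), hl i hi q, map_neg, map_neg,
          ← neg_sub', smul_neg]

theorem exists_section_fibre (l : Fin k) {v : TenComp k} (hv : v ∈ fibre k p) :
    ∃ s, IsSection (fibre k) s ∧ s p = v := by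
  obtain ⟨s, hs, hp, hsq, hl⟩ := exists_section_rotSlot_rotSlot l hv Finset.univ
  refine ⟨s, ⟨hs, fun q i j => ?_⟩, hp⟩
  have h : ∀ i, rotSlot i (q : R3) (s q) = rotSlot l (q : R3) (s q) := fun i => by
    have h1 := congrArg (rotSlot l (q : R3)) (hl i (Finset.mem_univ i) q)
    rw [rotSlot_comm_same l i (q : R3) (s q), rotSlot_comm_same l i, hsq l q, map_neg, map_neg] at h1
    exact neg_injective h1
  rw [h j, rotSlot_comm_same i l, hl i (Finset.mem_univ i) q]

/-- The complex structure given by the rotation of the factor with index `l`. -/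
def fibreJ (l : Fin k) (p : S2) : TenComp k →ₗ[ℝ] TenComp k := rotSlot l (p : R3)

theorem fibreJ_apply (l : Fin k) (p : S2) (x : TenComp k) : fibreJ l p x = rotSlot l (p : R3) x :=
  rfl

theorem isHermitianLineBundle_fibre (l : Fin k) : IsHermitianLineBundle (fibre k) (fibreJ l) where
  finrank_eq p := finrank_fibre p l
  exists_section p v hv := exists_section_fibre l hv
  J_mem p v hv := rotSlot_mem hv l
  J_J p v hv := hv l l
  J_inner p v _ w hw := by
    rw [fibreJ_apply, fibreJ_apply, inner_rotSlot, hw, inner_neg_right, neg_neg]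
  J_smooth s hs := ⟨smooth_rotSlot l hs.1, fun p => rotSlot_mem (hs.2 p) l⟩

/-- The covariant derivative for which the infinitesimal rotations `p × X` are parallel. -/
def covDeriv (X : S2 → R3) (s : S2 → TenComp k) (p : S2) : TenComp k :=
  dirDeriv s p (X p) - rotAll (crossL p (X p)) (s p)

theorem dirDeriv_rotSlot (j : Fin k) {s : S2 → TenComp k} (hs : Smooth s) {v : R3}
    (hv : v ∈ S2.tangent p) : dirDeriv (fun q => rotSlot j (q : R3) (s q)) p v =
      rotSlot j v (s p) + rotSlot j (p : R3) (dirDeriv s p v) := by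
  rw [dirDeriv_bilin (rotSlot j) smooth_coe hs, dirDeriv_coe hv]

/-- Both `D_X` and `ρ(p × X)` have the same commutator with each `R_j`, namely the rotation of the
`j`-th factor about `X`. Their difference commutes with every `R_j` and so preserves the equations
of the fibre. -/
theorem isSection_covDeriv {X : S2 → R3} {s : S2 → TenComp k} (hX : IsVectorField X)
    (hs : IsSection (fibre k) s) : IsSection (fibre k) (covDeriv X s) := by
  refine ⟨(hs.1.dirDeriv hX.1).sub ((smooth_coe.bilin crossL hX.1).bilin rotAll hs.1),
    fun p i j => ?_⟩
  have hv := hX.2 p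
  have h1 := dirDeriv_rotSlot i (smooth_rotSlot j hs.1) hv
  rw [dirDeriv_rotSlot j hs.1 hv, show (fun q : S2 => rotSlot i (q : R3) (rotSlot j (q : R3) (s q))) =
    fun q => -s q from funext fun q => hs.2 q i j, dirDeriv_neg hs.1, map_add] at h1
  have h2 := rotAll_rotSlot i (crossL p (X p)) p (rotSlot j (p : R3) (s p))
  rw [rotAll_rotSlot j, hs.2 p i j, crossL_crossL_coe hv, map_add, map_neg] at h2
  rw [covDeriv, map_sub, map_sub]
  linear_combination (norm := module) h2 - h1

theorem covDeriv_metric {X : S2 → R3} {s t : S2 → TenComp k} (hs : Smooth s) (ht : Smooth t)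
    (p : S2) : dirDeriv (fun q => ⟪s q, t q⟫) p (X p) =
      ⟪covDeriv X s p, t p⟫ + ⟪s p, covDeriv X t p⟫ := by
  rw [dirDeriv_inner hs ht, covDeriv, covDeriv, inner_sub_left, inner_sub_right, inner_rotAll]
  ring

/-- The connection `covDeriv` as a metric connection of the bundle. -/
def rotConnection (k : ℕ) : MetricConnection (fibre k) where
  D := covDeriv
  isSection _ _ hX hs := isSection_covDeriv hX hs
  add_left X Y s _ _ _ := by
    funext p
    simp only [covDeriv, dirDeriv_add_right, map_add, add_apply]
    abel
  smul_left f X s _ _ _ := by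
    funext p
    simp only [covDeriv, dirDeriv_smul_right, map_smul, smul_apply, smul_sub]
  add_right X s t _ hs ht := by
    funext p
    simp only [covDeriv, dirDeriv_add hs.1 ht.1, map_add]
    abel
  leibniz f X s hf _ hs := by
    funext p
    simp only [covDeriv, dirDeriv_smul hf hs.1, map_smul, smul_sub]
    abel
  metric X s t _ hs ht p := covDeriv_metric hs.1 ht.1 p

end TenComp

/-! ### The difference of two metric connections -/

section Difference

open S2

variable {V : Type*} [NormedAddCommGroup V] [InnerProductSpace ℝ V] {E : S2 → Submodule ℝ V}
  {J : S2 → V →ₗ[ℝ] V}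

/-! ### Linear algebra in the fibres of a hermitian line bundle -/

namespace IsHermitianLineBundle

theorem inner_J_self (h : IsHermitianLineBundle E J) {p : S2} {v : V} (hv : v ∈ E p) :
    ⟪v, J p v⟫ = 0 := by
  have h1 := h.J_inner p v hv (J p v) (h.J_mem p v hv)
  rw [h.J_J p v hv, inner_neg_right, real_inner_comm] at h1
  linarith

theorem inner_J_J (h : IsHermitianLineBundle E J) {p : S2} {v : V} (hv : v ∈ E p) :
    ⟪J p v, J p v⟫ = ⟪v, v⟫ := h.J_inner p v hv v hv

/-- Expansion of a vector in the orthogonal frame `v`, `J v`. -/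
theorem inner_self_smul (h : IsHermitianLineBundle E J) {p : S2} {v t : V} (hv : v ∈ E p)
    (ht : t ∈ E p) : ⟪v, v⟫ • t = ⟪t, v⟫ • v + ⟪t, J p v⟫ • J p v := by
  by_cases hv0 : v = 0
  · simp [hv0]
  have hJ := h.J_mem p v hv
  have h1 := h.inner_J_self hv
  have h2 := h.inner_J_J hv
  have hvv : ⟪v, v⟫ ≠ 0 := inner_self_ne_zero.2 hv0
  have hJ0 : J p v ≠ 0 := inner_self_ne_zero.1 (h2 ▸ hvv)
  let u : V := ⟪v, v⟫ • t - (⟪t, v⟫ • v + ⟪t, J p v⟫ • J p v)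
  have hu : u ∈ E p := Submodule.sub_mem _ (Submodule.smul_mem _ _ ht)
    (Submodule.add_mem _ (Submodule.smul_mem _ _ hv) (Submodule.smul_mem _ _ hJ))
  have hvu : ⟪v, u⟫ = 0 := by
    simp only [u, inner_sub_right, inner_add_right, inner_smul_right, h1, real_inner_comm t v]
    ring
  have hJu : ⟪J p v, u⟫ = 0 := by
    simp only [u, inner_sub_right, inner_add_right, inner_smul_right, h2,
      real_inner_comm v (J p v), h1, real_inner_comm t (J p v)]
    ring
  rw [← sub_eq_zero]
  by_contra hu0
  -- The ambient space may be infinite dimensional; finiteness is needed so that three independent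
  -- vectors contradict rank two.
  have hfin : Module.Finite ℝ (E p) :=
    Module.finite_of_finrank_pos (by rw [h.finrank_eq p]; norm_num)
  let w : Fin 3 → E p := ![⟨v, hv⟩, ⟨J p v, hJ⟩, ⟨u, hu⟩]
  have hw : LinearIndependent ℝ w := by
    refine linearIndependent_of_ne_zero_of_inner_eq_zero ?_ ?_
    · intro i
      fin_cases i
      · exact fun e => hv0 (congrArg Subtype.val e)
      · exact fun e => hJ0 (congrArg Subtype.val e)
      · exact fun e => hu0 (congrArg Subtype.val e)
    · intro i j hij
      fin_cases i <;> fin_cases j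
      · exact absurd rfl hij
      · exact h1
      · exact hvu
      · exact (real_inner_comm _ _).trans h1
      · exact absurd rfl hij
      · exact hJu
      · exact (real_inner_comm _ _).trans hvu
      · exact (real_inner_comm _ _).trans hJu
      · exact absurd rfl hij
  have := hw.fintype_card_le_finrank
  rw [h.finrank_eq p, Fintype.card_fin] at this
  omega

theorem exists_section_ne_zero (h : IsHermitianLineBundle E J) (p : S2) :
    ∃ s, IsSection E s ∧ s p ≠ 0 := by
  have : Nontrivial (E p) := Module.nontrivial_of_finrank_pos (R := ℝ) (by
    rw [h.finrank_eq p]; norm_num)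
  obtain ⟨v, hv⟩ := exists_ne (0 : E p)
  obtain ⟨s, hs, hsp⟩ := h.exists_section p v v.2
  exact ⟨s, hs, fun e => hv (Subtype.ext (hsp.symm.trans e))⟩

end IsHermitianLineBundle

/-! ### The difference of metric connections as a one-form -/

namespace MetricConnection

/-- The difference of two connections. -/
def diff (A B : MetricConnection E) (X : S2 → R3) (s : S2 → V) (p : S2) : V := A.D X s p - B.D X s p

variable (A B : MetricConnection E) {X : S2 → R3} {s t : S2 → V}

theorem isSection_diff (hX : IsVectorField X) (hs : IsSection E s) :
    IsSection E (A.diff B X s) :=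
  ⟨(A.isSection X s hX hs).1.sub (B.isSection X s hX hs).1, fun p =>
    Submodule.sub_mem _ ((A.isSection X s hX hs).2 p) ((B.isSection X s hX hs).2 p)⟩

theorem _root_.IsSection.smul {f : S2 → ℝ} (hf : Smooth f) (hs : IsSection E s) :
    IsSection E (fun p => f p • s p) :=
  ⟨hf.smul hs.1, fun p => Submodule.smul_mem _ _ (hs.2 p)⟩

/-- The derivative terms of the two Leibniz rules cancel, so the difference is linear over
functions. -/
theorem diff_smul {f : S2 → ℝ} (hf : Smooth f) (hX : IsVectorField X) (hs : IsSection E s)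
    (p : S2) : A.diff B X (fun q => f q • s q) p = f p • A.diff B X s p := by
  rw [diff, A.leibniz f X s hf hX hs, B.leibniz f X s hf hX hs, diff]
  module

theorem diff_add (hX : IsVectorField X) (hs : IsSection E s) (ht : IsSection E t) (p : S2) :
    A.diff B X (fun q => s q + t q) p = A.diff B X s p + A.diff B X t p := by
  rw [diff, A.add_right X s t hX hs ht, B.add_right X s t hX hs ht, diff, diff]
  exact add_sub_add_comm _ _ _ _

theorem inner_diff (hX : IsVectorField X) (hs : IsSection E s) (ht : IsSection E t) (p : S2) :
    ⟪A.diff B X s p, t p⟫ = -⟪s p, A.diff B X t p⟫ := by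
  have h1 := A.metric X s t hX hs ht p
  have h2 := B.metric X s t hX hs ht p
  rw [diff, diff, inner_sub_left, inner_sub_right]
  linarith

/-- The difference is a skew endomorphism of an oriented plane, hence a multiple of `J`. A global
frame need not exist, so the coefficient is computed from a section that is nonzero at the given
point. -/
theorem diff_eq_smul (h : IsHermitianLineBundle E J) (hX : IsVectorField X) (hs : IsSection E s)
    (ht : IsSection E t) {p : S2} (hp : s p ≠ 0) :
    A.diff B X t p = (⟪A.diff B X s p, J p (s p)⟫ * ⟪s p, s p⟫⁻¹) • J p (t p) := by
  have hJs := h.J_smooth s hs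
  have hss : ⟪s p, s p⟫ ≠ 0 := inner_self_ne_zero.2 hp
  -- The expansion in `s`, `J s` is multiplied by `|s|²` rather than divided by it: all coefficients
  -- are then global smooth functions and linearity over functions applies.
  have e1 : ⟪s p, s p⟫ • A.diff B X t p =
      ⟪t p, s p⟫ • A.diff B X s p + ⟪t p, J p (s p)⟫ • A.diff B X (fun q => J q (s q)) p := by
    rw [← diff_smul A B (hs.1.inner hs.1) hX ht, ← diff_smul A B (ht.1.inner hs.1) hX hs,
      ← diff_smul A B (ht.1.inner hJs.1) hX hJs,
      ← diff_add A B hX (hs.smul (ht.1.inner hs.1)) (hJs.smul (ht.1.inner hJs.1))]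
    exact congrArg (fun f => A.diff B X f p)
      (funext fun q => h.inner_self_smul (hs.2 q) (ht.2 q))
  have e2 := h.inner_self_smul (hs.2 p) ((isSection_diff A B hX hs).2 p)
  have e3 := h.inner_self_smul (hs.2 p) ((isSection_diff A B hX hJs).2 p)
  -- Skewness kills the diagonal entries (`i1`, `i2`) and makes the off-diagonal ones opposite
  -- (`i3`).
  have i1 := inner_diff A B hX hs hs p
  rw [real_inner_comm] at i1
  have i2 := inner_diff A B hX hJs hJs p
  rw [real_inner_comm] at i2
  have i3 := inner_diff A B hX hJs hs p
  rw [show ⟪A.diff B X s p, s p⟫ = 0 by rw [real_inner_comm]; linarith, zero_smul, zero_add] at e2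
  rw [show ⟪A.diff B X (fun q => J q (s q)) p, J p (s p)⟫ = 0 by rw [real_inner_comm]; linarith,
    zero_smul, add_zero, i3, real_inner_comm (A.diff B X s p)] at e3
  have e4 := congrArg (J p) (h.inner_self_smul (hs.2 p) (ht.2 p))
  rw [map_smul, map_add, map_smul, map_smul, h.J_J p _ (hs.2 p)] at e4
  have e5 : (⟪s p, s p⟫ * ⟪s p, s p⟫) • A.diff B X t p =
      (⟪s p, s p⟫ * ⟪A.diff B X s p, J p (s p)⟫) • J p (t p) := by
    linear_combination (norm := module) ⟪s p, s p⟫ • e1 + ⟪t p, s p⟫ • e2 +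
      ⟪t p, J p (s p)⟫ • e3 - ⟪A.diff B X s p, J p (s p)⟫ • e4
  refine smul_right_injective V (mul_ne_zero hss hss) (e5.trans ?_)
  simp only [smul_smul]
  congr 1
  field_simp

theorem exists_smooth_diff_eq (h : IsHermitianLineBundle E J) (hX : IsVectorField X) :
    ∃ β : S2 → ℝ, Smooth β ∧ ∀ t, IsSection E t → ∀ p, A.diff B X t p = β p • J p (t p) := by
  choose s hs hne using h.exists_section_ne_zero
  -- Each point uses its own section. The coefficient does not depend on this choice, so near `p` it
  -- is given by the smooth expression in the one section `s p`.
  refine ⟨fun p => ⟪A.diff B X (s p) p, J p (s p p)⟫ * ⟪s p p, s p p⟫⁻¹, fun p => ?_,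
    fun t ht p => diff_eq_smul A B h hX (hs p) ht (hne p)⟩
  have hN := (hs p).1.inner (hs p).1
  have hJs := h.J_smooth _ (hs p)
  have hD := (isSection_diff A B hX (hs p)).1.inner hJs.1
  have h1 : ContMDiffAt (𝓡 2) 𝓘(ℝ, ℝ) ∞
      (fun q => ⟪A.diff B X (s p) q, J q (s p q)⟫ * ⟪s p q, s p q⟫⁻¹) p := by
    have h2 : ContMDiffAt (𝓡 2) 𝓘(ℝ, ℝ) ∞ (fun q => ⟪s p q, s p q⟫⁻¹) p :=
      ((contDiffAt_inv ℝ (inner_self_ne_zero.2 (hne p))).contMDiffAt).comp p (hN p)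
    exact (contDiff_mul.contMDiff _).comp p ((hD p).prodMk_space h2)
  refine h1.congr_of_eventuallyEq ?_
  filter_upwards [(hs p).1.continuous.continuousAt.eventually_ne (hne p)] with q hq
  have e1 := diff_eq_smul A B h hX (hs p) (hs q) hq
  rw [e1, inner_smul_left, h.inner_J_J ((hs q).2 q)]
  have : ⟪s q q, s q q⟫ ≠ 0 := inner_self_ne_zero.2 (hne q)
  simp only [conj_trivial]
  rw [mul_assoc _ ⟪s q q, s q q⟫, mul_inv_cancel₀ this, mul_one]

/-- The tangential part of the `c`-th coordinate vector. -/
def _root_.S2.coordField (c : Fin 3) (p : S2) : R3 :=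
  EuclideanSpace.single c 1 - (p : R3) c • (p : R3)

theorem _root_.S2.smooth_apply {f : S2 → R3} (hf : Smooth f) (c : Fin 3) :
    Smooth (fun p => f p c) := hf.clm (EuclideanSpace.proj c : R3 →L[ℝ] ℝ)

theorem _root_.S2.isVectorField_coordField (c : Fin 3) : IsVectorField (coordField c) := by
  refine ⟨(smooth_const _).sub ((smooth_apply smooth_coe c).smul smooth_coe), fun p => ?_⟩
  rw [mem_tangent_iff, coordField, inner_sub_right, inner_smul_right, real_inner_self_eq_norm_sq,
    norm_coe]
  simp [EuclideanSpace.inner_single_right]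

theorem _root_.S2.IsVectorField.smul {f : S2 → ℝ} (hf : Smooth f) (hX : IsVectorField X) :
    IsVectorField (fun p => f p • X p) :=
  ⟨hf.smul hX.1, fun p => Submodule.smul_mem _ _ (hX.2 p)⟩

theorem _root_.S2.IsVectorField.add {Y : S2 → R3} (hX : IsVectorField X) (hY : IsVectorField Y) :
    IsVectorField (fun p => X p + Y p) :=
  ⟨hX.1.add hY.1, fun p => Submodule.add_mem _ (hX.2 p) (hY.2 p)⟩

/-- The normal parts of the coordinate fields cancel because `⟨p, X⟩ = 0`. Thus three global fields
generate all vector fields over the functions. -/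
theorem _root_.S2.IsVectorField.eq_sum_coordField (hX : IsVectorField X) :
    X = fun p => X p 0 • coordField 0 p + (X p 1 • coordField 1 p + X p 2 • coordField 2 p) := by
  funext p
  have h := mem_tangent_iff.1 (hX.2 p)
  rw [R3.inner_eq] at h
  apply R3.ext <;> simp [coordField]
  · linear_combination (p : R3) 0 * h
  · linear_combination (p : R3) 1 * h
  · linear_combination (p : R3) 2 * h

theorem diff_eq_sum_coordField (hX : IsVectorField X) (hs : IsSection E s) (p : S2) :
    A.diff B X s p = X p 0 • A.diff B (coordField 0) s p +
      (X p 1 • A.diff B (coordField 1) s p + X p 2 • A.diff B (coordField 2) s p) := by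
  have hf := fun c => smooth_apply hX.1 c
  have hT := isVectorField_coordField
  have key : ∀ C : MetricConnection E, C.D X s p = X p 0 • C.D (coordField 0) s p +
      (X p 1 • C.D (coordField 1) s p + X p 2 • C.D (coordField 2) s p) := fun C => by
    conv_lhs => rw [hX.eq_sum_coordField]
    rw [C.add_left _ _ s ((hT 0).smul (hf 0)) (((hT 1).smul (hf 1)).add ((hT 2).smul (hf 2))) hs,
      C.add_left _ _ s ((hT 1).smul (hf 1)) ((hT 2).smul (hf 2)) hs,
      C.smul_left _ _ s (hf 0) (hT 0) hs, C.smul_left _ _ s (hf 1) (hT 1) hs,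
      C.smul_left _ _ s (hf 2) (hT 2) hs]
  simp only [diff, key A, key B]
  module

/-- Two metric connections differ by a one-form times the complex structure. -/
theorem exists_oneForm (h : IsHermitianLineBundle E J) :
    ∃ b : S2 → R3, Smooth b ∧ ∀ X s, IsVectorField X → IsSection E s → ∀ p,
      A.D X s p = B.D X s p + ⟪b p, X p⟫ • J p (s p) := by
  choose β hβ hd using fun c => exists_smooth_diff_eq A B h (isVectorField_coordField c)
  refine ⟨fun p => ∑ c, β c p • EuclideanSpace.single c (1 : ℝ),
    Smooth.sum _ fun c => (hβ c).smul (smooth_const _), fun X s hX hs p => ?_⟩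
  have e := diff_eq_sum_coordField A B hX hs p
  rw [hd 0 s hs p, hd 1 s hs p, hd 2 s hs p, diff, sub_eq_iff_eq_add'] at e
  rw [e, R3.inner_eq]
  simp [Fin.sum_univ_three]
  module

end MetricConnection

end Difference

/-! ### The curvature of a metric connection and the Euler number -/

namespace S2

/-- The curl of the field `b` along the sphere, in the normal direction. -/
def normalCurl (b : S2 → R3) (p : S2) : ℝ :=
  ∑ c, dirDeriv (fun q => b q c) p (crossL (EuclideanSpace.single c 1) p)

theorem smooth_normalCurl {b : S2 → R3} (hb : Smooth b) : Smooth (normalCurl b) :=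
  Smooth.sum _ fun c => (smooth_apply hb c).dirDeriv ((smooth_const _).bilin crossL smooth_coe)

/-- Each summand is the derivative of a function along the infinitesimal rotation `e_c × p`. -/
theorem integral_normalCurl {b : S2 → R3} (hb : Smooth b) : ∫ p, normalCurl b p ∂area = 0 := by
  unfold normalCurl
  rw [MeasureTheory.integral_finsetSum _ fun c _ =>
    ((smooth_apply hb c).dirDeriv ((smooth_const _).bilin crossL smooth_coe)).integrable]
  exact Finset.sum_eq_zero fun c _ =>
    integral_dirDeriv_skew (smooth_apply hb c) _ fun x => inner_crossL_right _ x

/-- The antisymmetric part of `L` pairs with `(v, w)` only through `v × w`, which equals `vol p v w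
• p`; the sum is the normal component of the curl of `L`. -/
theorem inner_sub_inner_eq_vol_mul {p : S2} {v w : R3} (hv : v ∈ tangent p) (hw : w ∈ tangent p)
    (L : R3 →L[ℝ] R3) : ⟪L v, w⟫ - ⟪L w, v⟫ =
      vol p v w * ∑ c, L (crossL (EuclideanSpace.single c 1) p) c := by
  have hL : ∀ x c, L x c = x 0 * L (EuclideanSpace.single 0 1) c +
      x 1 * L (EuclideanSpace.single 1 1) c + x 2 * L (EuclideanSpace.single 2 1) c := by
    intro x c
    have : x = x 0 • EuclideanSpace.single 0 (1 : ℝ) + x 1 • EuclideanSpace.single 1 (1 : ℝ) +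
        x 2 • EuclideanSpace.single 2 (1 : ℝ) := by apply R3.ext <;> simp
    conv_lhs => rw [this]
    simp
  have h := crossL_tangent hv hw
  have h0 := congrArg (fun x : R3 => x 0) h
  have h1 := congrArg (fun x : R3 => x 1) h
  have h2 := congrArg (fun x : R3 => x 2) h
  simp only [crossL_zero, crossL_one, crossL_two, PiLp.smul_apply, smul_eq_mul] at h0 h1 h2
  rw [Fin.sum_univ_three, R3.inner_eq, R3.inner_eq, hL v, hL v, hL v, hL w, hL w, hL w,
    hL (crossL _ _), hL (crossL _ _), hL (crossL _ _)]
  simp only [crossL_zero, crossL_one, crossL_two]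
  generalize L (EuclideanSpace.single 0 1) = u0
  generalize L (EuclideanSpace.single 1 1) = u1
  generalize L (EuclideanSpace.single 2 1) = u2
  simp
  linear_combination (u0 1 - u1 0) * h2 + (u1 2 - u2 1) * h0 + (u2 0 - u0 2) * h1

theorem inner_dirDeriv_sub_eq {b : S2 → R3} (hb : Smooth b) {p : S2} {v w : R3}
    (hv : v ∈ tangent p) (hw : w ∈ tangent p) :
    ⟪dirDeriv b p v, w⟫ - ⟪dirDeriv b p w, v⟫ = vol p v w * normalCurl b p := by
  have h := inner_sub_inner_eq_vol_mul hv hw (fderiv ℝ (fun x => b (retract x)) (p : R3))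
  refine h.trans (congrArg _ (Finset.sum_congr rfl fun c _ => ?_))
  exact (dirDeriv_clm (EuclideanSpace.proj c : R3 →L[ℝ] ℝ) hb p _).symm

theorem vol_swap (p : S2) (v w : R3) : vol p w v = -vol p v w := by
  simp only [vol_eq, R3.inner_eq, crossL_zero, crossL_one, crossL_two]
  ring

end S2

/-! ### Curvature of an arbitrary metric connection and the Euler number -/

namespace TenComp

open S2

variable {k : ℕ}

theorem second_covariant_derivative (l : Fin k) {A : MetricConnection (fibre k)} {b : S2 → R3}
    (hb : Smooth b)
    (hA : ∀ X s, IsVectorField X → IsSection (fibre k) s → ∀ p,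
      A.D X s p = covDeriv X s p + ⟪b p, X p⟫ • rotSlot l (p : R3) (s p))
    {X Y : S2 → R3} {s : S2 → TenComp k} (hX : IsVectorField X) (hY : IsVectorField Y)
    (hs : IsSection (fibre k) s) (p : S2) :
    A.D X (A.D Y s) p =
      dirDeriv (fun q => dirDeriv s q (Y q)) p (X p) -
        (rotAll (crossL (X p) (Y p)) (s p) + rotAll (crossL p (dirDeriv Y p (X p))) (s p) +
          rotAll (crossL p (Y p)) (dirDeriv s p (X p))) +
        ((⟪dirDeriv b p (X p), Y p⟫ + ⟪b p, dirDeriv Y p (X p)⟫) • rotSlot l (p : R3) (s p) +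
          ⟪b p, Y p⟫ • (rotSlot l (X p) (s p) + rotSlot l (p : R3) (dirDeriv s p (X p)))) -
        rotAll (crossL p (X p)) (dirDeriv s p (Y p) - rotAll (crossL p (Y p)) (s p) +
          ⟪b p, Y p⟫ • rotSlot l (p : R3) (s p)) +
        ⟪b p, X p⟫ • rotSlot l (p : R3) (dirDeriv s p (Y p) - rotAll (crossL p (Y p)) (s p) +
          ⟪b p, Y p⟫ • rotSlot l (p : R3) (s p)) := by
  have hfun : A.D Y s = fun q => dirDeriv s q (Y q) - rotAll (crossL q (Y q)) (s q) +
      ⟪b q, Y q⟫ • rotSlot l (q : R3) (s q) := funext fun q => hA Y s hY hs q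
  have h1 := hs.1.dirDeriv hY.1
  have h2 := smooth_coe.bilin crossL hY.1
  have h3 := h2.bilin rotAll hs.1
  have h4 := hb.inner hY.1
  have h5 := smooth_rotSlot l hs.1
  rw [hA X _ hX (A.isSection Y s hY hs), covDeriv, hfun, dirDeriv_add (h1.sub h3) (h4.smul h5),
    dirDeriv_sub h1 h3, dirDeriv_bilin rotAll h2 hs.1, dirDeriv_bilin crossL smooth_coe hY.1,
    dirDeriv_coe (hX.2 p), dirDeriv_smul h4 h5, dirDeriv_inner hb hY.1,
    dirDeriv_rotSlot l hs.1 (hX.2 p), map_add rotAll, add_apply]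

/-- Differentiating `p` in `ρ(p × Y)` and antisymmetrizing gives `-2 ρ(X × Y) = -2 k vol J`. The
commutator of `ρ(p × X)` and `ρ(p × Y)` returns `+k vol J`, leaving `-k vol J`. The one-form adds
`normalCurl b · vol J`; its mixed terms cancel because `J` is parallel (`e2`, `e3`), and its
quadratic terms because `J` commutes with itself. -/
theorem curv_eq (l : Fin k) {A : MetricConnection (fibre k)} {b : S2 → R3} (hb : Smooth b)
    (hA : ∀ X s, IsVectorField X → IsSection (fibre k) s → ∀ p,
      A.D X s p = covDeriv X s p + ⟪b p, X p⟫ • rotSlot l (p : R3) (s p)) :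
    A.IsCurvature (fibreJ l) (fun p => k - normalCurl b p) := by
  intro X Y s hX hY hs p
  rw [MetricConnection.curv, second_covariant_derivative l hb hA hX hY hs,
    second_covariant_derivative l hb hA hY hX hs, hA _ s (hX.bracket hY) hs, covDeriv,
    dirDeriv_bracket hs.1 hX hY, fibreJ_apply]
  have hcurl := inner_dirDeriv_sub_eq hb (hX.2 p) (hY.2 p)
  have e1 := rotAll_rotAll (crossL p (X p)) (crossL p (Y p)) (s p)
  rw [crossL_crossL_crossL, map_smul, smul_apply, rotAll_of_mem (hs.2 p) l] at e1
  have e2 := rotAll_rotSlot l (crossL p (X p)) p (s p)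
  rw [crossL_crossL_coe (hX.2 p)] at e2
  have e3 := rotAll_rotSlot l (crossL p (Y p)) p (s p)
  rw [crossL_crossL_coe (hY.2 p)] at e3
  have e4 : rotAll (crossL (X p) (Y p)) (s p) =
      vol p (X p) (Y p) • (k : ℝ) • rotSlot l (p : R3) (s p) := by
    rw [crossL_tangent (hX.2 p) (hY.2 p), map_smul, smul_apply, rotAll_of_mem (hs.2 p) l]
  have e5 : rotAll (crossL (Y p) (X p)) (s p) =
      -(vol p (X p) (Y p) • (k : ℝ) • rotSlot l (p : R3) (s p)) := by
    rw [crossL_tangent (hY.2 p) (hX.2 p), vol_swap, neg_smul, map_neg, neg_apply, map_smul,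
      smul_apply, rotAll_of_mem (hs.2 p) l]
  have e6 : rotAll (crossL p (S2.bracket X Y p)) (s p) =
      rotAll (crossL p (dirDeriv Y p (X p))) (s p) -
        rotAll (crossL p (dirDeriv X p (Y p))) (s p) := by
    rw [S2.bracket, map_sub, map_sub, sub_apply]
  have e7 : ⟪b p, S2.bracket X Y p⟫ = ⟪b p, dirDeriv Y p (X p)⟫ - ⟪b p, dirDeriv X p (Y p)⟫ := by
    rw [S2.bracket, inner_sub_right]
  rw [e4, e5, e6, e7]
  simp only [map_add, map_sub, map_smul]
  have hcurl' := congrArg (fun c : ℝ => c • rotSlot l (p : R3) (s p)) hcurl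
  linear_combination (norm := module) e1 - ⟪b p, Y p⟫ • e2 + ⟪b p, X p⟫ • e3 + hcurl'

theorem hasEulerNumber_fibre (l : Fin k) : HasEulerNumber (fibre k) (fibreJ l) (2 * (k : ℤ)) := by
  refine ⟨isHermitianLineBundle_fibre l, ⟨rotConnection k⟩, fun A => ?_⟩
  obtain ⟨b, hb, hA⟩ := A.exists_oneForm (rotConnection k) (isHermitianLineBundle_fibre l)
  refine ⟨fun p => k - normalCurl b p, (smooth_const _).sub (smooth_normalCurl hb),
    curv_eq l hb hA, ?_⟩
  rw [MeasureTheory.integral_sub (smooth_const _).integrable (smooth_normalCurl hb).integrable,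
    integral_normalCurl hb, MeasureTheory.integral_const, area_real_univ]
  have := Real.pi_ne_zero
  push_cast
  rw [smul_eq_mul]
  field_simp
  ring

end TenComp

end

theorem mainTheorem6 (k : ℕ) (hk : 2 ≤ k) :
    HasEulerNumber (symTrBundle k) (symTrJ k) (2 * (k : ℤ)) := by
  obtain ⟨m, rfl⟩ := Nat.exists_eq_add_of_le' hk
  have h1 : symTrBundle (m + 2) = TenComp.fibre (m + 2) :=
    funext fun p => TenComp.symTrBundle_eq_fibre m p
  have h2 : symTrJ (m + 2) = TenComp.fibreJ (0 : Fin (m + 2)) :=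
    funext fun p => LinearMap.ext fun x => TenComp.symTrJ_apply m p x
  rw [h1, h2]
  exact TenComp.hasEulerNumber_fibre 0
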